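/- \textbf{Setting.} Let $A\in\mathbb R^{n\times n}$, $B\in\mathbb R^{n\times l}$ with $(A,B)$ stabilizable, $E\in\mathbb R^{n\times m}$, $z\in\mathbb R^n$; let $Q_1,Q_2\in\mathbb R^{n\times n}$ and $R_1,R_2\in\mathbb R^{l\times l}$ be symmetric with $Q_1,Q_2,R_2\ge 0$, $R_1>0$; let $s\in\mathbb R^n$, $v\in\mathbb R^l$, $c\in\mathbb R$. On a probability space $(\Omega,\mathcal F,\mathbb P)$ let $W(0),W(1),\dots$ be i.i.d. $\mathbb R^m$-valued random variables whose law $\varrho_W$ has finite second moment and mean $\mu_W$, and assume that for every $\varrho_0\in\mathcal P_2(\mathbb R^n)$ (probability measures with finite second moment) the space carries a random variable $X_0\sim\varrho_0$ independent of the sequence $W(\cdot)$. Put $f(X,U,W)=AX+BU+EW+z$, $\|x\|_M^2=x^TMx$, and, for $X\in L^2(\Omega;\mathbb R^n)$, $U\in L^2(\Omega;\mathbb R^l)$, $$\ell(X,U)=\mathbb E\big[X^TQ_1X+U^TR_1U+s^TX+v^TU+c\big]+\mathrm{Tr}(Q_2\,\mathrm{Cov}(X))+\mathrm{Tr}(R_2\,\mathrm{Cov}(U)).$$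 \textbf{Theorem.} Assume that $(x^s,u^s)\in\mathbb R^n\times\mathbb R^l$ satisfies $(I-A)x^s-Bu^s=E\mu_W+z$ and that $(A,Q_1^{1/2})$ is detectable. Then the following hold. (i) The Riccati equation $$P=A^TPA+(Q_1+Q_2)-A^TPB\,[(R_1+R_2)+B^TPB]^{-1}B^TPA$$ has exactly one symmetric positive semidefinite solution $P$. Put $K=-[(R_1+R_2)+B^TPB]^{-1}B^TPA$. (ii) There are a symmetric positive definite $S\in\mathbb R^{n\times n}$, a vector $q\in\mathbb R^n$, a pair $(\tilde x^s_\star,\tilde u^s_\star)\in\mathbb R^n\times\mathbb R^l$ with $(I-A)\tilde x^s_\star-B\tilde u^s_\star=0$, and $r>0$ such that, with $\alpha(t)=rt$, with $\tilde\lambda(X)=\mathbb E[\|X\|_S^2+q^TX]$, and with $\hat\ell$ denoting the cost $\ell$ in which $s,v,c$ are replaced by $s+2Q_1x^s$, $v+2R_1u^s$ and ${x^s}^TQ_1x^s+{u^s}^TR_1u^s+s^Tx^s+v^Tu^s+c$, one has for all $\tilde X\in L^2(\Omega;\mathbb R^n)$, $\tilde U\in L^2(\Omega;\mathbb R^l)$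 $$\hat\ell(\tilde X,\tilde U)-\hat\ell(\tilde x^s_\star,\tilde u^s_\star)+\tilde\lambda(\tilde X)-\tilde\lambda(A\tilde X+B\tilde U)\ \ge\ \alpha\big(\mathbb E\|\tilde X-\tilde x^s_\star\|^2\big),$$ and moreover (iii) and (iv) hold with these data. (iii) There are a distribution $\varrho_X^{s,\star}\in\mathcal P_2(\mathbb R^n)$ and an initial value $X^s_\star(0)\sim\varrho_X^{s,\star}$, independent of the sequence $W(\cdot)$, such that the processes $$X^s_\star(k+1)=f(X^s_\star(k),U^s_\star(k),W(k)),\qquad U^s_\star(k)=K(X^s_\star(k)-\tilde x^s_\star-x^s)+\tilde u^s_\star+u^s$$ form a stationary pair: for all $k\in\mathbb N_0$, $X^s_\star(k)\sim\varrho_X^{s,\star}$, $U^s_\star(k)\sim\varrho_U$ for a fixed $\varrho_U\in\mathcal P_2(\mathbb R^l)$, and $W(k)$ is independent of $X^s_\star(k)$ and of $U^s_\star(k)$. The distribution $\varrho_X^{s,\star}$ is invariant for the Markov chain given by this closed loop. (iv) The stochastic linear-quadratic problem with dynamics $f$ and stage cost $\ell$ is strictly dissipative in $L^2$ at $(X^s_\star(\cdot),U^s_\star(\cdot))$,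 with storage function $$\lambda(k,X)=\mathbb E\Big[\|X-(X^s_\star(k)-\tilde x^s_\star)\|_{P+S}^2-\|X-x^s\|_P^2+q^T\big(X-(X^s_\star(k)-\tilde x^s_\star)\big)\Big]$$ and $\alpha(t)=rt$. That is, $\lambda$ is bounded from below uniformly in $k\in\mathbb N_0$ and $X\in L^2(\Omega;\mathbb R^n)$, and for all $k\in\mathbb N_0$ and all $X\in L^2(\Omega;\mathbb R^n)$, $U\in L^2(\Omega;\mathbb R^l)$ that are each independent of $W(k)$, $$\ell(X,U)-\ell(X^s_\star(k),U^s_\star(k))+\lambda(k,X)-\lambda\big(k+1,f(X,U,W(k))\big)\ \ge\ \alpha\big(\mathbb E\|X-X^s_\star(k)\|^2\big).$$ -/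

import Mathlib

open MeasureTheory ProbabilityTheory
open scoped Matrix MatrixOrder

noncomputable section

namespace StochLQ

/-- Euclidean space `ℝᵈ`. -/
abbrev Vec (d : ℕ) : Type := EuclideanSpace ℝ (Fin d)

/-- Matrix-vector product on Euclidean spaces. -/
abbrev act {a b : ℕ} (M : Matrix (Fin a) (Fin b) ℝ) (x : Vec b) : Vec a :=
  Matrix.toEuclideanLin M x

/-- The quadratic form `‖x‖_M² = xᵀ M x`. -/
def quad {d : ℕ} (M : Matrix (Fin d) (Fin d) ℝ) (x : Vec d) : ℝ :=
  inner ℝ x (act M x)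

/-- All complex eigenvalues lie in the open unit disc. -/
def IsSchurStable {d : ℕ} (M : Matrix (Fin d) (Fin d) ℝ) : Prop :=
  ∀ ζ ∈ spectrum ℂ (M.map (algebraMap ℝ ℂ)), ‖ζ‖ < 1

/-- `(A, B)` is stabilizable. -/
def IsStabilizable {n l : ℕ} (A : Matrix (Fin n) (Fin n) ℝ) (B : Matrix (Fin n) (Fin l) ℝ) :
    Prop :=
  ∃ F : Matrix (Fin l) (Fin n) ℝ, IsSchurStable (A + B * F)

/-- `(A, C)` is detectable. -/
def IsDetectable {n d : ℕ} (A : Matrix (Fin n) (Fin n) ℝ) (C : Matrix (Fin d) (Fin n) ℝ) :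
    Prop :=
  ∃ L : Matrix (Fin n) (Fin d) ℝ, IsSchurStable (A + L * C)

/-- The class `𝒦_∞` of comparison functions on `[0, ∞)`. -/
structure IsClassKInfty (α : ℝ → ℝ) : Prop where
  continuousOn : ContinuousOn α (Set.Ici 0)
  strictMonoOn : StrictMonoOn α (Set.Ici 0)
  map_zero : α 0 = 0
  unbounded : ∀ c : ℝ, ∃ t : ℝ, 0 ≤ t ∧ c < α t

/-- Probability measures with finite second moment. -/
structure IsP2 {d : ℕ} (ρ : Measure (Vec d)) : Prop where
  isProbabilityMeasure : IsProbabilityMeasure ρ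
  integrable_sq : Integrable (fun x => ‖x‖ ^ 2) ρ

/-- The coefficients of the linear dynamics `x⁺ = A x + B u + E w + z`. -/
structure Dynamics (n l m : ℕ) where
  A : Matrix (Fin n) (Fin n) ℝ
  B : Matrix (Fin n) (Fin l) ℝ
  E : Matrix (Fin n) (Fin m) ℝ
  z : Vec n

/-- The right-hand side `f(x, u, w)` of the dynamics. -/
def Dynamics.f {n l m : ℕ} (D : Dynamics n l m) (x : Vec n) (u : Vec l) (w : Vec m) : Vec n :=
  act D.A x + act D.B u + act D.E w + D.z

/-- The coefficients of the stage cost. -/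
structure Cost (n l : ℕ) where
  Q₁ : Matrix (Fin n) (Fin n) ℝ
  Q₂ : Matrix (Fin n) (Fin n) ℝ
  R₁ : Matrix (Fin l) (Fin l) ℝ
  R₂ : Matrix (Fin l) (Fin l) ℝ
  s : Vec n
  v : Vec l
  c : ℝ

/-- The covariance matrix of a random vector. -/
def covMat {Ω : Type*} [MeasurableSpace Ω] (μ : Measure Ω) {d : ℕ} (X : Ω → Vec d) :
    Matrix (Fin d) (Fin d) ℝ :=
  Matrix.of fun i j => covariance (fun ω => X ω i) (fun ω => X ω j) μ

/-- The stage cost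
`ℓ(X, U) = 𝔼[Xᵀ Q₁ X + Uᵀ R₁ U + sᵀ X + vᵀ U + c] + Tr(Q₂ Cov X) + Tr(R₂ Cov U)`. -/
def Cost.ell {n l : ℕ} (C : Cost n l) {Ω : Type*} [MeasurableSpace Ω] (μ : Measure Ω)
    (X : Ω → Vec n) (U : Ω → Vec l) : ℝ :=
  (∫ ω, (quad C.Q₁ (X ω) + quad C.R₁ (U ω) + inner ℝ C.s (X ω) + inner ℝ C.v (U ω) + C.c) ∂μ)
    + (C.Q₂ * covMat μ X).trace + (C.R₂ * covMat μ U).trace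

/-- The cost coefficients after the change of variables `x = x̂ + xs`, `u = û + us`. -/
def Cost.shift {n l : ℕ} (C : Cost n l) (xs : Vec n) (us : Vec l) : Cost n l where
  Q₁ := C.Q₁
  Q₂ := C.Q₂
  R₁ := C.R₁
  R₂ := C.R₂
  s := C.s + (2 : ℝ) • act C.Q₁ xs
  v := C.v + (2 : ℝ) • act C.R₁ us
  c := quad C.Q₁ xs + quad C.R₁ us + inner ℝ C.s xs + inner ℝ C.v us + C.c

/-- `P` is a positive semidefinite solution of the discrete-time algebraic Riccati equation with
weights `Q₁ + Q₂` and `R₁ + R₂`. -/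
def IsRiccatiSolution {n l m : ℕ} (D : Dynamics n l m) (C : Cost n l)
    (P : Matrix (Fin n) (Fin n) ℝ) : Prop :=
  P.PosSemidef ∧
    P = D.Aᵀ * P * D.A + (C.Q₁ + C.Q₂)
      - D.Aᵀ * P * D.B * ((C.R₁ + C.R₂) + D.Bᵀ * P * D.B)⁻¹ * D.Bᵀ * P * D.A

/-- The feedback gain `K = -[(R₁ + R₂) + Bᵀ P B]⁻¹ Bᵀ P A`. -/
def gain {n l m : ℕ} (D : Dynamics n l m) (C : Cost n l) (P : Matrix (Fin n) (Fin n) ℝ) :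
    Matrix (Fin l) (Fin n) ℝ :=
  -(((C.R₁ + C.R₂) + D.Bᵀ * P * D.B)⁻¹ * D.Bᵀ * P * D.A)

/-- `ρ` is invariant under the Markov chain `x⁺ = f(x, π x, w)` with noise law `ρW`. -/
def IsInvariant {n l m : ℕ} (D : Dynamics n l m) (ρW : Measure (Vec m))
    (π : Vec n → Vec l) (ρ : Measure (Vec n)) : Prop :=
  (ρ.prod ρW).map (fun p => D.f p.1 (π p.1) p.2) = ρ

/-- `(Xs, Us)` is a stationary pair with marginal laws `ρX` and `ρU`, driven by the noise `W`. As
for all state and control processes, `W k` is independent of `Xs k` and of `Us k`. -/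
structure IsStationaryPair {n l m : ℕ} (D : Dynamics n l m) {Ω : Type*} [MeasurableSpace Ω]
    (μ : Measure Ω) (W : ℕ → Ω → Vec m) (Xs : ℕ → Ω → Vec n) (Us : ℕ → Ω → Vec l)
    (ρX : Measure (Vec n)) (ρU : Measure (Vec l)) : Prop where
  isP2_state : IsP2 ρX
  isP2_control : IsP2 ρU
  law_state : ∀ k, HasLaw (Xs k) ρX μ
  law_control : ∀ k, HasLaw (Us k) ρU μ
  indep_state : ∀ k, IndepFun (Xs k) (W k) μ
  indep_control : ∀ k, IndepFun (Us k) (W k) μ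
  step : ∀ k ω, Xs (k + 1) ω = D.f (Xs k ω) (Us k ω) (W k ω)

/-- The stochastic optimal control problem is strictly dissipative in `L²` at `(Xs, Us)` with
time-varying storage function `lam` and comparison function `α`. The admissible random variables
at time `k` are the square integrable ones that are independent of the noise `W k`. -/
structure IsStrictlyDissipative {n l m : ℕ} (D : Dynamics n l m) (C : Cost n l)
    {Ω : Type*} [MeasurableSpace Ω] (μ : Measure Ω) (W : ℕ → Ω → Vec m)
    (Xs : ℕ → Ω → Vec n) (Us : ℕ → Ω → Vec l)
    (lam : ℕ → (Ω → Vec n) → ℝ) (α : ℝ → ℝ) : Prop where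
  classKInfty : IsClassKInfty α
  bddBelow : ∃ M : ℝ, ∀ k X, MemLp X 2 μ → M ≤ lam k X
  dissipation : ∀ (k : ℕ) (X : Ω → Vec n) (U : Ω → Vec l), MemLp X 2 μ → MemLp U 2 μ →
    IndepFun X (W k) μ → IndepFun U (W k) μ →
    α (∫ ω, ‖X ω - Xs k ω‖ ^ 2 ∂μ) ≤
      C.ell μ X U - C.ell μ (Xs k) (Us k) + lam k X
        - lam (k + 1) (fun ω => D.f (X ω) (U ω) (W k ω))

/-- The storage function `𝔼[‖X‖_S² + qᵀ X]` of the noise-free error system. -/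
def errorStorage {n : ℕ} {Ω : Type*} [MeasurableSpace Ω] (μ : Measure Ω)
    (S : Matrix (Fin n) (Fin n) ℝ) (q : Vec n) (X : Ω → Vec n) : ℝ :=
  ∫ ω, (quad S (X ω) + inner ℝ q (X ω)) ∂μ

/-- Strict dissipativity of the noise-free error system `X⁺ = A X + B U` with cost `C` at the
point `(xt, ut)`, with storage function `errorStorage μ S q`. -/
def IsErrorDissipative {n l m : ℕ} (D : Dynamics n l m) (C : Cost n l)
    {Ω : Type*} [MeasurableSpace Ω] (μ : Measure Ω) (S : Matrix (Fin n) (Fin n) ℝ)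
    (q xt : Vec n) (ut : Vec l) (α : ℝ → ℝ) : Prop :=
  ∀ (X : Ω → Vec n) (U : Ω → Vec l), MemLp X 2 μ → MemLp U 2 μ →
    α (∫ ω, ‖X ω - xt‖ ^ 2 ∂μ) ≤
      C.ell μ X U - C.ell μ (fun _ => xt) (fun _ => ut) + errorStorage μ S q X
        - errorStorage μ S q (fun ω => act D.A (X ω) + act D.B (U ω))

/-- The storage function
`λ(k, X) = 𝔼[‖X - (Xs(k) - xt)‖_{P+S}² - ‖X - xs‖_P² + qᵀ (X - (Xs(k) - xt))]`. -/
def storage {n : ℕ} {Ω : Type*} [MeasurableSpace Ω] (μ : Measure Ω)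
    (P S : Matrix (Fin n) (Fin n) ℝ) (q xs xt : Vec n) (Xs : ℕ → Ω → Vec n)
    (k : ℕ) (X : Ω → Vec n) : ℝ :=
  ∫ ω, (quad (P + S) (X ω - (Xs k ω - xt)) - quad P (X ω - xs)
    + inner ℝ q (X ω - (Xs k ω - xt))) ∂μ

end StochLQ

end

/-!
Detectability turns a Lyapunov function of the observer error into a positive definite `S` with
`‖A x + B u‖_S² ≤ ‖x‖_S² - r ‖x‖² + ‖x‖_{Q₁}² + ‖u‖_{R₁}²`. After subtracting the supporting affine
function given by the Lagrange multiplier of the optimal steady state, this is strict dissipativity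
of the noise-free error system. The same `S` makes the Riccati solution `P` unique and its closed
loop stable: `P + S` is a Lyapunov function of `A + B K`.

In the stochastic problem write `X - xs = Y + Z` and `U - us = T + K Z`, where `Z = Xs k - xt - xs`
is the centered stationary state. The polarised Riccati equation expresses the mixed terms of the
cost through `𝔼⟨Y, P Z⟩` and `𝔼⟨A Y + B T, P (A + B K) Z⟩`. The storage difference contributes
exactly their negatives, because the noise entering `Z` is centered and independent of `Y` and `T`.
What remains is the dissipation inequality of the error system for the pair `(Y, T)`.
-/

namespace StochLQ

open Filter Topology

section Algebra

variable {a b d : ℕ}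

theorem mul_act (M : Matrix (Fin a) (Fin b) ℝ) (N : Matrix (Fin b) (Fin d) ℝ) (x : Vec d) :
    act (M * N) x = act M (act N x) := by
  rw [act, Matrix.toLpLin_mul_same, LinearMap.comp_apply]

theorem add_act (M N : Matrix (Fin a) (Fin b) ℝ) (x : Vec b) :
    act (M + N) x = act M x + act N x := by
  rw [act, map_add, LinearMap.add_apply]

theorem sub_act (M N : Matrix (Fin a) (Fin b) ℝ) (x : Vec b) :
    act (M - N) x = act M x - act N x := by
  rw [act, map_sub, LinearMap.sub_apply]

theorem smul_act (c : ℝ) (M : Matrix (Fin a) (Fin b) ℝ) (x : Vec b) :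
    act (c • M) x = c • act M x := by
  rw [act, map_smul, LinearMap.smul_apply]

theorem one_act (x : Vec a) : act (1 : Matrix (Fin a) (Fin a) ℝ) x = x := by
  rw [act, Matrix.toLpLin_one, LinearMap.id_apply]

theorem zero_act (x : Vec b) : act (0 : Matrix (Fin a) (Fin b) ℝ) x = 0 := by
  rw [act, map_zero, LinearMap.zero_apply]

theorem continuous_act (M : Matrix (Fin a) (Fin b) ℝ) : Continuous (act M) :=
  (Matrix.toEuclideanLin M).continuous_of_finiteDimensional

theorem inner_act (M : Matrix (Fin a) (Fin b) ℝ) (x : Vec a) (y : Vec b) :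
    inner ℝ x (act M y) = inner ℝ (act Mᵀ x) y := by
  rw [← Matrix.conjTranspose_eq_transpose_of_trivial, act, act,
    Matrix.toEuclideanLin_conjTranspose_eq_adjoint, LinearMap.adjoint_inner_left]

theorem inner_act_comm {M : Matrix (Fin d) (Fin d) ℝ} (hM : M.IsHermitian) (x y : Vec d) :
    inner ℝ x (act M y) = inner ℝ y (act M x) := by
  rw [inner_act, Matrix.isHermitian_iff_isSymm.1 hM, real_inner_comm]

theorem quad_eq_dotProduct (M : Matrix (Fin d) (Fin d) ℝ) (x : Vec d) :
    quad M x = star x.ofLp ⬝ᵥ (M *ᵥ x.ofLp) := by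
  rw [quad, EuclideanSpace.inner_eq_star_dotProduct, dotProduct_comm, act,
    Matrix.ofLp_toLpLin, Matrix.toLin'_apply]

theorem add_quad (M N : Matrix (Fin d) (Fin d) ℝ) (x : Vec d) :
    quad (M + N) x = quad M x + quad N x := by
  rw [quad, add_act, inner_add_right, quad, quad]

theorem sub_quad (M N : Matrix (Fin d) (Fin d) ℝ) (x : Vec d) :
    quad (M - N) x = quad M x - quad N x := by
  rw [quad, sub_act, inner_sub_right, quad, quad]

theorem smul_quad (c : ℝ) (M : Matrix (Fin d) (Fin d) ℝ) (x : Vec d) :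
    quad (c • M) x = c * quad M x := by
  rw [quad, smul_act, real_inner_smul_right, quad]

theorem quad_smul (M : Matrix (Fin d) (Fin d) ℝ) (c : ℝ) (x : Vec d) :
    quad M (c • x) = c ^ 2 * quad M x := by
  simp only [quad, map_smul, real_inner_smul_left, real_inner_smul_right]
  ring

theorem transpose_mul_mul_quad (M : Matrix (Fin a) (Fin a) ℝ) (N : Matrix (Fin a) (Fin d) ℝ)
    (x : Vec d) : quad (Nᵀ * M * N) x = quad M (act N x) := by
  rw [quad, mul_act, mul_act, inner_act, Matrix.transpose_transpose, quad]

theorem transpose_mul_self_quad (N : Matrix (Fin a) (Fin d) ℝ) (x : Vec d) :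
    quad (Nᵀ * N) x = ‖act N x‖ ^ 2 := by
  rw [quad, mul_act, inner_act, Matrix.transpose_transpose, real_inner_self_eq_norm_sq]

theorem quad_add {M : Matrix (Fin d) (Fin d) ℝ} (hM : M.IsHermitian) (x y : Vec d) :
    quad M (x + y) = quad M x + 2 * inner ℝ x (act M y) + quad M y := by
  simp only [quad, map_add, inner_add_left, inner_add_right, inner_act_comm hM y x]
  ring

theorem quad_sub {M : Matrix (Fin d) (Fin d) ℝ} (hM : M.IsHermitian) (x y : Vec d) :
    quad M (x - y) = quad M x - 2 * inner ℝ x (act M y) + quad M y := by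
  simp only [quad, map_sub, inner_sub_left, inner_sub_right, inner_act_comm hM y x]
  ring

theorem posSemidef_iff_quad {M : Matrix (Fin d) (Fin d) ℝ} :
    M.PosSemidef ↔ M.IsHermitian ∧ ∀ x, 0 ≤ quad M x := by
  rw [Matrix.posSemidef_iff_dotProduct_mulVec]
  simp only [quad_eq_dotProduct]
  exact and_congr_right fun _ => (WithLp.equiv 2 (Fin d → ℝ)).surjective.forall

theorem quad_nonneg {M : Matrix (Fin d) (Fin d) ℝ} (hM : M.PosSemidef) (x : Vec d) :
    0 ≤ quad M x :=
  (posSemidef_iff_quad.1 hM).2 x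

theorem le_iff_quad_le {M N : Matrix (Fin d) (Fin d) ℝ} (hM : M.IsHermitian)
    (hN : N.IsHermitian) : M ≤ N ↔ ∀ x, quad M x ≤ quad N x := by
  simp only [Matrix.le_iff, posSemidef_iff_quad, hN.sub hM, true_and, sub_quad, sub_nonneg]

theorem quad_mono {M N : Matrix (Fin d) (Fin d) ℝ} (h : M ≤ N) (x : Vec d) :
    quad M x ≤ quad N x := by
  simpa only [sub_quad, sub_nonneg] using quad_nonneg (Matrix.le_iff.1 h) x

theorem quad_pos {M : Matrix (Fin d) (Fin d) ℝ} (hM : M.PosDef) {x : Vec d} (hx : x ≠ 0) :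
    0 < quad M x := by
  rw [quad_eq_dotProduct]
  exact hM.dotProduct_mulVec_pos (by simpa using hx)

theorem quad_sqrt {Q : Matrix (Fin d) (Fin d) ℝ} (hQ : Q.PosSemidef) (x : Vec d) :
    quad Q x = ‖act (CFC.sqrt Q) x‖ ^ 2 := by
  have hsymm : (CFC.sqrt Q)ᵀ = CFC.sqrt Q := Matrix.isHermitian_iff_isSymm.1
    (Matrix.nonneg_iff_posSemidef.1 (CFC.sqrt_nonneg Q)).isHermitian
  rw [← transpose_mul_self_quad, hsymm, CFC.sqrt_mul_sqrt_self Q hQ.nonneg]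

theorem exists_norm_act_sq_le (M : Matrix (Fin a) (Fin b) ℝ) :
    ∃ c : ℝ, 0 < c ∧ ∀ x, ‖act M x‖ ^ 2 ≤ c * ‖x‖ ^ 2 := by
  obtain ⟨c, hc, h⟩ := (Matrix.toEuclideanLin M).toContinuousLinearMap.bound
  exact ⟨c ^ 2, by positivity, fun x => mul_pow c ‖x‖ 2 ▸ pow_le_pow_left₀ (norm_nonneg _) (h x) 2⟩

theorem exists_quad_le {M : Matrix (Fin d) (Fin d) ℝ} (hM : M.PosSemidef) :
    ∃ c : ℝ, 0 < c ∧ ∀ x, quad M x ≤ c * ‖x‖ ^ 2 := by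
  simpa only [quad_sqrt hM] using exists_norm_act_sq_le (CFC.sqrt M)

theorem exists_le_quad {M : Matrix (Fin d) (Fin d) ℝ} (hM : M.PosDef) :
    ∃ c : ℝ, 0 < c ∧ ∀ x, c * ‖x‖ ^ 2 ≤ quad M x := by
  obtain ⟨N, hN⟩ := ((CFC.isUnit_sqrt_iff M hM.posSemidef.nonneg).2 hM.isUnit).exists_left_inv
  obtain ⟨c, hc, h⟩ := exists_norm_act_sq_le N
  refine ⟨c⁻¹, inv_pos.2 hc, fun x => (inv_mul_le_iff₀ hc).2 ?_⟩
  calc ‖x‖ ^ 2 = ‖act N (act (CFC.sqrt M) x)‖ ^ 2 := by rw [← mul_act, hN, one_act]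
    _ ≤ c * ‖act (CFC.sqrt M) x‖ ^ 2 := h _
    _ = c * quad M x := by rw [quad_sqrt hM.posSemidef]

theorem quad_add_le {V : Matrix (Fin d) (Fin d) ℝ} (hV : V.PosSemidef) {δ : ℝ} (hδ : 0 < δ)
    (x y : Vec d) : quad V (x + y) ≤ (1 + δ) * quad V x + (1 + δ⁻¹) * quad V y := by
  have h : 0 ≤ quad V ((δ : ℝ) • x - y) := quad_nonneg hV _
  rw [quad_sub hV.1, quad_smul, real_inner_smul_left] at h
  have h' : 0 ≤ δ * quad V x - 2 * inner ℝ x (act V y) + δ⁻¹ * quad V y := by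
    calc 0 ≤ δ⁻¹ * (δ ^ 2 * quad V x - 2 * (δ * inner ℝ x (act V y)) + quad V y) := by positivity
      _ = _ := by field_simp
  rw [quad_add hV.1]
  linarith

end Algebra

section Stability

theorem tendsto_pow_of_forall_mem_spectrum_norm_lt_one {A : Type*} [NormedRing A]
    [NormedAlgebra ℂ A] [CompleteSpace A] {a : A} (h : ∀ z ∈ spectrum ℂ a, ‖z‖ < 1) :
    Tendsto (fun k : ℕ => a ^ k) atTop (𝓝 0) := by
  rcases subsingleton_or_nontrivial A with _ | _
  · exact tendsto_const_nhds.congr fun k => Subsingleton.elim 0 (a ^ k)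
  have hradius : spectralRadius ℂ a < ((1 : NNReal) : ENNReal) :=
    spectrum.spectralRadius_lt_of_forall_lt a fun z hz => by exact_mod_cast h z hz
  obtain ⟨r, hr, hr1⟩ := ENNReal.lt_iff_exists_nnreal_btwn.1 hradius
  have hgeom : Tendsto (fun k : ℕ => (r : ℝ) ^ k) atTop (𝓝 0) :=
    tendsto_pow_atTop_nhds_zero_of_lt_one r.2 (by exact_mod_cast hr1)
  refine squeeze_zero_norm' ?_ hgeom
  have hgelfand := spectrum.pow_nnnorm_pow_one_div_tendsto_nhds_spectralRadius a
  filter_upwards [hgelfand.eventually_lt_const hr, eventually_gt_atTop 0] with k hroot hk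
  have hnorm := ENNReal.rpow_le_rpow hroot.le (Nat.cast_nonneg (α := ℝ) k)
  rw [← ENNReal.rpow_mul, one_div_mul_cancel (Nat.cast_ne_zero.2 hk.ne'), ENNReal.rpow_one,
    ENNReal.rpow_natCast] at hnorm
  exact_mod_cast hnorm

variable {d : ℕ} {M V : Matrix (Fin d) (Fin d) ℝ}

attribute [local instance] Matrix.linftyOpNormedRing Matrix.linftyOpNormedAlgebra in
theorem IsSchurStable.tendsto_pow (hM : IsSchurStable M) :
    Tendsto (fun k : ℕ => M ^ k) atTop (𝓝 0) := by
  have hre : Continuous fun N : Matrix (Fin d) (Fin d) ℂ => N.map Complex.re :=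
    continuous_id.matrix_map Complex.continuous_re
  have h := (hre.tendsto 0).comp (tendsto_pow_of_forall_mem_spectrum_norm_lt_one hM)
  rw [Matrix.map_zero _ Complex.zero_re] at h
  refine h.congr fun k => ?_
  rw [Function.comp_apply, ← RingHom.mapMatrix_apply, ← map_pow, RingHom.mapMatrix_apply,
    Matrix.map_map]
  exact Matrix.map_id _

theorem tendsto_toEuclideanCLM_pow (h : Tendsto (fun k : ℕ => M ^ k) atTop (𝓝 0)) :
    Tendsto (fun k : ℕ => Matrix.toEuclideanCLM (𝕜 := ℝ) M ^ k) atTop (𝓝 0) := by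
  have hcont : Continuous (Matrix.toEuclideanCLM (n := Fin d) (𝕜 := ℝ)) :=
    (Matrix.toEuclideanCLM (n := Fin d) (𝕜 := ℝ)).toAlgEquiv.toLinearMap
      |>.continuous_of_finiteDimensional
  simpa only [Function.comp_def, map_pow, map_zero] using (hcont.tendsto 0).comp h

theorem toEuclideanCLM_pow_apply (k : ℕ) (x : Vec d) :
    (Matrix.toEuclideanCLM (𝕜 := ℝ) M ^ k) x = act (M ^ k) x := by
  rw [← map_pow]
  rfl

theorem tendsto_act_pow (h : Tendsto (fun k : ℕ => M ^ k) atTop (𝓝 0)) (x : Vec d) :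
    Tendsto (fun k : ℕ => act (M ^ k) x) atTop (𝓝 0) := by
  simp only [← toEuclideanCLM_pow_apply]
  exact ((ContinuousLinearMap.apply ℝ (Vec d) x).continuous.tendsto' 0 0 (map_zero _)).comp
    (tendsto_toEuclideanCLM_pow h)

theorem eq_zero_of_act_eq_self (h : Tendsto (fun k : ℕ => M ^ k) atTop (𝓝 0)) {x : Vec d}
    (hx : act M x = x) : x = 0 := by
  refine tendsto_nhds_unique (tendsto_const_nhds.congr fun k => ?_) (tendsto_act_pow h x)
  induction k with
  | zero => rw [pow_zero, one_act]
  | succ k ih => rw [pow_succ, mul_act, hx, ← ih]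

theorem tendsto_transpose_pow (h : Tendsto (fun k : ℕ => M ^ k) atTop (𝓝 0)) :
    Tendsto (fun k : ℕ => Mᵀ ^ k) atTop (𝓝 0) := by
  simpa only [Function.comp_def, Matrix.transpose_pow, Matrix.transpose_zero, id] using
    (continuous_id.matrix_transpose.tendsto (0 : Matrix (Fin d) (Fin d) ℝ)).comp h

/-- The Gramian of `x⁺ = M x` over the horizon `N`: its quadratic form is the energy
`∑_{k < N} ‖M ^ k x‖²` of the first `N` states of the trajectory starting in `x`. -/
def gramian (M : Matrix (Fin d) (Fin d) ℝ) (N : ℕ) : Matrix (Fin d) (Fin d) ℝ :=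
  ∑ k ∈ Finset.range N, (M ^ k)ᵀ * M ^ k

theorem gramian_quad (N : ℕ) (x : Vec d) :
    quad (gramian M N) x = ∑ k ∈ Finset.range N, ‖act (M ^ k) x‖ ^ 2 := by
  simp only [← transpose_mul_self_quad, quad, act, gramian, map_sum, LinearMap.sum_apply, inner_sum]

theorem posDef_gramian_succ (N : ℕ) : (gramian M (N + 1)).PosDef := by
  rw [gramian, Finset.sum_range_succ']
  refine Matrix.PosDef.posSemidef_add (Matrix.posSemidef_sum _ fun k _ => ?_) ?_
  · exact Matrix.posSemidef_conjTranspose_mul_self (M ^ (k + 1))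
  · simpa using Matrix.PosDef.one

theorem gramian_quad_act (N : ℕ) (x : Vec d) :
    quad (gramian M N) (act M x) = quad (gramian M N) x - ‖x‖ ^ 2 + ‖act (M ^ N) x‖ ^ 2 := by
  rw [gramian_quad, gramian_quad, sub_add_eq_add_sub, eq_sub_iff_add_eq,
    ← Finset.sum_range_succ (fun k => ‖act (M ^ k) x‖ ^ 2), Finset.sum_range_succ']
  simp only [pow_zero, one_act, pow_succ M, mul_act]

/-- `quad V` is a strict quadratic Lyapunov function, with decay rate `r`, for `x⁺ = M x`. -/
structure IsLyapunov (V M : Matrix (Fin d) (Fin d) ℝ) (r : ℝ) : Prop where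
  posDef : V.PosDef
  pos : 0 < r
  decrease : ∀ x, quad V (act M x) ≤ quad V x - r * ‖x‖ ^ 2

theorem exists_isLyapunov (h : Tendsto (fun k : ℕ => M ^ k) atTop (𝓝 0)) :
    ∃ V r, IsLyapunov V M r := by
  obtain ⟨N, hN⟩ : ∃ N : ℕ, ∀ x, ‖act (M ^ (N + 1)) x‖ ≤ (1 / 2) * ‖x‖ := by
    have hnorm := (tendsto_toEuclideanCLM_pow h).norm.comp (tendsto_add_atTop_nat 1)
    rw [norm_zero] at hnorm
    obtain ⟨N, hN⟩ := (hnorm.eventually_le_const (show (0 : ℝ) < 1 / 2 by norm_num)).exists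
    exact ⟨N, fun x => toEuclideanCLM_pow_apply (M := M) _ x ▸
      ContinuousLinearMap.le_of_opNorm_le _ hN x⟩
  refine ⟨gramian M (N + 1), 1 / 2, posDef_gramian_succ N, by norm_num, fun x => ?_⟩
  rw [gramian_quad_act]
  nlinarith [hN x, norm_nonneg (act (M ^ (N + 1)) x), norm_nonneg x]

theorem IsLyapunov.sum_norm_act_pow_sq_le {r : ℝ} (h : IsLyapunov V M r) (x : Vec d) (N : ℕ) :
    ∑ k ∈ Finset.range N, ‖act (M ^ k) x‖ ^ 2 ≤ quad V x / r := by
  have htelescope : quad V (act (M ^ N) x) + r * ∑ k ∈ Finset.range N, ‖act (M ^ k) x‖ ^ 2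
      ≤ quad V x := by
    induction N with
    | zero => simp [one_act]
    | succ N ih =>
      rw [Finset.sum_range_succ, pow_succ', mul_act]
      linarith [h.decrease (act (M ^ N) x)]
  rw [le_div_iff₀' h.pos]
  linarith [quad_nonneg h.posDef.posSemidef (act (M ^ N) x)]

theorem IsLyapunov.tendsto_pow {r : ℝ} (h : IsLyapunov V M r) :
    Tendsto (fun k : ℕ => M ^ k) atTop (𝓝 0) := by
  have hact (x : Vec d) : Tendsto (fun k : ℕ => act (M ^ k) x) atTop (𝓝 0) := by
    have hsq := (summable_of_sum_range_le (fun k => sq_nonneg _)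
      (h.sum_norm_act_pow_sq_le x)).tendsto_atTop_zero
    rw [tendsto_zero_iff_norm_tendsto_zero]
    simpa using hsq.sqrt
  refine tendsto_pi_nhds.2 fun i => tendsto_pi_nhds.2 fun j => ?_
  have hentry := ((EuclideanSpace.proj (𝕜 := ℝ) i).continuous.tendsto 0).comp
    (hact (EuclideanSpace.single j 1))
  rw [map_zero] at hentry
  refine hentry.congr fun k => ?_
  rw [Function.comp_apply, PiLp.proj_apply, act, Matrix.toLpLin_apply, PiLp.ofLp_single,
    Matrix.mulVec_single_one]
  rfl

end Stability

section StrictStorage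

variable {n l : ℕ} {A Q Q' S : Matrix (Fin n) (Fin n) ℝ} {B : Matrix (Fin n) (Fin l) ℝ}
  {R R' : Matrix (Fin l) (Fin l) ℝ}

theorem IsLyapunov.exists_quad_act_add_le {V M : Matrix (Fin n) (Fin n) ℝ} {r : ℝ}
    (h : IsLyapunov V M r) : ∃ c : ℝ, 0 < c ∧ ∀ x w,
      quad V (act M x + w) ≤ quad V x - r / 2 * ‖x‖ ^ 2 + c * ‖w‖ ^ 2 := by
  obtain ⟨b, hb, hVb⟩ := exists_quad_le h.posDef.posSemidef
  have hr := h.pos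
  set δ := r / (2 * b) with hδ_def
  have hδ : 0 < δ := by positivity
  refine ⟨(1 + δ⁻¹) * b, by positivity, fun x w => ?_⟩
  have hcontract : δ * quad V (act M x) ≤ r / 2 * ‖x‖ ^ 2 :=
    calc δ * quad V (act M x) ≤ δ * (b * ‖x‖ ^ 2) := by
          have : 0 ≤ r * ‖x‖ ^ 2 := by positivity
          gcongr
          linarith [h.decrease x, hVb x]
      _ = r / 2 * ‖x‖ ^ 2 := by rw [hδ_def]; field_simp
  calc quad V (act M x + w)
      ≤ (1 + δ) * quad V (act M x) + (1 + δ⁻¹) * quad V w :=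
        quad_add_le h.posDef.posSemidef hδ _ _
    _ ≤ quad V x - r / 2 * ‖x‖ ^ 2 + (1 + δ⁻¹) * (b * ‖w‖ ^ 2) := by
        have : (1 + δ⁻¹) * quad V w ≤ (1 + δ⁻¹) * (b * ‖w‖ ^ 2) := by gcongr; exact hVb w
        linarith [h.decrease x]
    _ = quad V x - r / 2 * ‖x‖ ^ 2 + (1 + δ⁻¹) * b * ‖w‖ ^ 2 := by ring

theorem exists_norm_act_sub_act_sq_le {d : ℕ} (B : Matrix (Fin n) (Fin l) ℝ)
    (L : Matrix (Fin n) (Fin d) ℝ) (hR : R.PosDef) :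
    ∃ c : ℝ, 0 < c ∧ ∀ u y, ‖act B u - act L y‖ ^ 2 ≤ c * (‖y‖ ^ 2 + quad R u) := by
  obtain ⟨cB, hcB, hB⟩ := exists_norm_act_sq_le B
  obtain ⟨cL, hcL, hL⟩ := exists_norm_act_sq_le L
  obtain ⟨a, ha, hRa⟩ := exists_le_quad hR
  refine ⟨2 * (cB / a + cL), by positivity, fun u y => ?_⟩
  have hBu : ‖act B u‖ ^ 2 ≤ cB / a * quad R u :=
    calc ‖act B u‖ ^ 2 ≤ cB / a * (a * ‖u‖ ^ 2) := (hB u).trans_eq (by field_simp)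
      _ ≤ cB / a * quad R u := by gcongr; exact hRa u
  have hR0 := quad_nonneg hR.posSemidef u
  calc ‖act B u - act L y‖ ^ 2 ≤ 2 * (‖act B u‖ ^ 2 + ‖act L y‖ ^ 2) := by
        have := parallelogram_law_with_norm ℝ (act B u) (act L y)
        nlinarith [sq_nonneg ‖act B u + act L y‖]
    _ ≤ 2 * (cB / a * quad R u + cL * ‖y‖ ^ 2) := by gcongr; exact hL y
    _ ≤ 2 * (cB / a + cL) * (‖y‖ ^ 2 + quad R u) := by
        have : 0 ≤ cB / a * ‖y‖ ^ 2 + cL * quad R u := by positivity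
        linarith

/-- `quad S` is a strict storage function, with rate `r`, of `x⁺ = A x + B u` for the supply rate
`‖x‖_Q² + ‖u‖_R²`. -/
structure IsStrictStorage (A : Matrix (Fin n) (Fin n) ℝ) (B : Matrix (Fin n) (Fin l) ℝ)
    (Q : Matrix (Fin n) (Fin n) ℝ) (R : Matrix (Fin l) (Fin l) ℝ) (S : Matrix (Fin n) (Fin n) ℝ)
    (r : ℝ) : Prop where
  posDef : S.PosDef
  pos : 0 < r
  dissipation : ∀ x u,
    r * ‖x‖ ^ 2 ≤ quad Q x + quad R u + quad S x - quad S (act A x + act B u)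

theorem IsStrictStorage.add_weights {r : ℝ} (h : IsStrictStorage A B Q R S r)
    (hQ' : Q'.PosSemidef) (hR' : R'.PosSemidef) : IsStrictStorage A B (Q + Q') (R + R') S r where
  posDef := h.posDef
  pos := h.pos
  dissipation x u := by
    rw [add_quad, add_quad]
    linarith [h.dissipation x u, quad_nonneg hQ' x, quad_nonneg hR' u]

theorem IsDetectable.exists_isStrictStorage (hdet : IsDetectable A (CFC.sqrt Q))
    (hQ : Q.PosSemidef) (hR : R.PosDef) (B : Matrix (Fin n) (Fin l) ℝ) :
    ∃ S r, IsStrictStorage A B Q R S r := by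
  obtain ⟨L, hL⟩ := hdet
  obtain ⟨V, r, hV⟩ := exists_isLyapunov hL.tendsto_pow
  obtain ⟨c₁, hc₁, hiss⟩ := hV.exists_quad_act_add_le
  obtain ⟨c₂, hc₂, hinput⟩ := exists_norm_act_sub_act_sq_le B L hR
  set c := c₁ * c₂
  have hc : 0 < c := mul_pos hc₁ hc₂
  have hr := hV.pos
  have hdecrease (x : Vec n) (u : Vec l) :
      quad V (act A x + act B u) ≤ quad V x - r / 2 * ‖x‖ ^ 2 + c * (quad Q x + quad R u) := by
    have hsplit : act A x + act B u = act (A + L * CFC.sqrt Q) x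
        + (act B u - act L (act (CFC.sqrt Q) x)) := by
      rw [add_act, mul_act]
      abel
    rw [hsplit, quad_sqrt hQ, mul_assoc]
    grw [hiss, hinput]
  refine ⟨c⁻¹ • V, c⁻¹ * (r / 2), hV.posDef.smul (inv_pos.2 hc), by positivity, fun x u => ?_⟩
  have hscaled := mul_le_mul_of_nonneg_left (hdecrease x u) (inv_nonneg.2 hc.le)
  rw [mul_add, inv_mul_cancel_left₀ hc.ne'] at hscaled
  rw [smul_quad, smul_quad]
  linarith

end StrictStorage

section SteadyState

variable {n l : ℕ} {A Q S : Matrix (Fin n) (Fin n) ℝ} {B : Matrix (Fin n) (Fin l) ℝ}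
  {R : Matrix (Fin l) (Fin l) ℝ} {s x q : Vec n} {v u : Vec l} {r : ℝ}

theorem act_one_sub_sub_act_eq_zero_iff :
    act (1 - A) x - act B u = 0 ↔ act A x + act B u = x := by
  rw [sub_act, one_act, sub_sub, sub_eq_zero, eq_comm]

/-- The optimality system, with Lagrange multiplier `q`, of the problem of minimizing
`‖x‖_Q² + ‖u‖_R² + sᵀ x + vᵀ u` over the steady states `(1 - A) x - B u = 0`. -/
structure IsOptimalSteadyState (A : Matrix (Fin n) (Fin n) ℝ) (B : Matrix (Fin n) (Fin l) ℝ)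
    (Q : Matrix (Fin n) (Fin n) ℝ) (R : Matrix (Fin l) (Fin l) ℝ) (s : Vec n) (v : Vec l)
    (x : Vec n) (u : Vec l) (q : Vec n) : Prop where
  state : (2 : ℝ) • act Q x + act (1 - A)ᵀ q = -s
  control : (2 : ℝ) • act R u - act Bᵀ q = -v
  steady : act (1 - A) x - act B u = 0

theorem IsOptimalSteadyState.cost_sub_cost (h : IsOptimalSteadyState A B Q R s v x u q)
    (hQ : Q.IsHermitian) (hR : R.IsHermitian) (y : Vec n) (t : Vec l) :
    quad Q y + quad R t + inner ℝ s y + inner ℝ v t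
        - (quad Q x + quad R u + inner ℝ s x + inner ℝ v u)
        + inner ℝ q (y - (act A y + act B t))
      = quad Q (y - x) + quad R (t - u) := by
  obtain ⟨d, rfl⟩ : ∃ d, y = d + x := ⟨y - x, (sub_add_cancel y x).symm⟩
  obtain ⟨w, rfl⟩ : ∃ w, t = w + u := ⟨t - u, (sub_add_cancel t u).symm⟩
  have hstate : 2 * inner ℝ d (act Q x) + inner ℝ q (act (1 - A) d) = -inner ℝ s d := by
    rw [inner_act (1 - A) q, real_inner_comm d, real_inner_comm d s, ← real_inner_smul_right,
      ← inner_add_right, h.state, inner_neg_right]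
  have hcontrol : 2 * inner ℝ w (act R u) - inner ℝ q (act B w) = -inner ℝ v w := by
    rw [inner_act B q, real_inner_comm w, real_inner_comm w v, ← real_inner_smul_right,
      ← inner_sub_right, h.control, inner_neg_right]
  have hdynamics : d + x - (act A (d + x) + act B (w + u)) = act (1 - A) d - act B w := by
    nth_rw 1 [← act_one_sub_sub_act_eq_zero_iff.1 h.steady]
    simp only [map_add, sub_act, one_act]
    abel
  rw [hdynamics, quad_add hQ, quad_add hR, add_sub_cancel_right, add_sub_cancel_right,
    inner_add_right, inner_add_right, inner_sub_right]
  linarith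

theorem IsOptimalSteadyState.eq_zero (h : IsOptimalSteadyState A B Q R 0 0 x u q)
    (hAB : IsStabilizable A B) (hQ : Q.PosSemidef) (hR : R.PosDef)
    (hS : IsStrictStorage A B Q R S r) : x = 0 ∧ u = 0 ∧ q = 0 := by
  have hcost : quad Q x + quad R u = 0 := by
    have h0 := h.cost_sub_cost hQ.1 hR.1 0 0
    simp only [quad, map_zero, inner_zero_left, inner_zero_right, zero_sub, map_neg, inner_neg_neg,
      add_zero, neg_zero] at h0 ⊢
    linarith
  have hx : x = 0 := by
    have hle := hS.dissipation x u
    rw [act_one_sub_sub_act_eq_zero_iff.1 h.steady, hcost, zero_add, sub_self] at hle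
    exact norm_eq_zero.1 (pow_eq_zero_iff two_ne_zero |>.1
      (le_antisymm (nonpos_of_mul_nonpos_right hle hS.pos) (sq_nonneg _)))
  have hu : u = 0 := by
    by_contra hu
    linarith [quad_pos hR hu, quad_nonneg hQ x]
  obtain ⟨F, hF⟩ := hAB
  have hq : act (A + B * F)ᵀ q = q := by
    have hA : act Aᵀ q = q := by
      have := h.state
      simp only [hx, map_zero, smul_zero, zero_add, neg_zero, Matrix.transpose_sub,
        Matrix.transpose_one, sub_act, one_act, sub_eq_zero] at this
      exact this.symm
    have hB : act Bᵀ q = 0 := by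
      have := h.control
      simpa only [hu, map_zero, smul_zero, zero_sub, neg_inj] using this
    simp only [Matrix.transpose_add, Matrix.transpose_mul, add_act, mul_act, hA, hB, map_zero,
      add_zero]
  exact ⟨hx, hu, eq_zero_of_act_eq_self (tendsto_transpose_pow hF.tendsto_pow) hq⟩

theorem exists_isOptimalSteadyState (hAB : IsStabilizable A B) (hQ : Q.PosSemidef)
    (hR : R.PosDef) (hS : IsStrictStorage A B Q R S r) (s : Vec n) (v : Vec l) :
    ∃ x u q, IsOptimalSteadyState A B Q R s v x u q := by
  let L {a b : ℕ} (M : Matrix (Fin a) (Fin b) ℝ) : Vec b →ₗ[ℝ] Vec a := Matrix.toEuclideanLin M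
  let state := LinearMap.fst ℝ (Vec n) (Vec l × Vec n)
  let control := LinearMap.fst ℝ (Vec l) (Vec n) ∘ₗ LinearMap.snd ℝ (Vec n) (Vec l × Vec n)
  let multiplier := LinearMap.snd ℝ (Vec l) (Vec n) ∘ₗ LinearMap.snd ℝ (Vec n) (Vec l × Vec n)
  let φ : Vec n × Vec l × Vec n →ₗ[ℝ] Vec n × Vec l × Vec n :=
    ((2 : ℝ) • (L Q ∘ₗ state) + L (1 - A)ᵀ ∘ₗ multiplier).prod
      (((2 : ℝ) • (L R ∘ₗ control) - L Bᵀ ∘ₗ multiplier).prod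
        (L (1 - A) ∘ₗ state - L B ∘ₗ control))
  have hφ (s : Vec n) (v : Vec l) (x : Vec n) (u : Vec l) (q : Vec n)
      (h : φ (x, u, q) = (-s, -v, 0)) : IsOptimalSteadyState A B Q R s v x u q :=
    ⟨congrArg Prod.fst h, congrArg (·.2.1) h, congrArg (·.2.2) h⟩
  have hinj : Function.Injective φ := by
    refine (injective_iff_map_eq_zero φ).2 ?_
    rintro ⟨x, u, q⟩ h0
    have hopt : IsOptimalSteadyState A B Q R 0 0 x u q := by
      refine hφ 0 0 x u q ?_
      rw [h0, neg_zero, neg_zero]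
      rfl
    obtain ⟨rfl, rfl, rfl⟩ := hopt.eq_zero hAB hQ hR hS
    rfl
  obtain ⟨⟨x, u, q⟩, h⟩ := LinearMap.injective_iff_surjective.1 hinj (-s, -v, 0)
  exact ⟨x, u, q, hφ s v x u q h⟩

/-- The stage cost `C.ell` of a deterministic state-control pair, for which the covariances
vanish. -/
noncomputable def Cost.point (C : Cost n l) (x : Vec n) (u : Vec l) : ℝ :=
  quad C.Q₁ x + quad C.R₁ u + inner ℝ C.s x + inner ℝ C.v u + C.c

theorem Cost.exists_point_dissipation (C : Cost n l) (hAB : IsStabilizable A B)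
    (hQ : C.Q₁.PosSemidef) (hR : C.R₁.PosDef) (hS : IsStrictStorage A B C.Q₁ C.R₁ S r) :
    ∃ (q xt : Vec n) (ut : Vec l), act (1 - A) xt - act B ut = 0 ∧ ∀ x u,
      r * ‖x - xt‖ ^ 2 ≤ C.point x u - C.point xt ut + (quad S x + inner ℝ q x)
        - (quad S (act A x + act B u) + inner ℝ q (act A x + act B u)) := by
  obtain ⟨xt, ut, q, h⟩ := exists_isOptimalSteadyState hAB hQ hR hS C.s C.v
  refine ⟨q - (2 : ℝ) • act S xt, xt, ut, h.steady, fun x u => ?_⟩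
  have hcost := h.cost_sub_cost hQ.1 hR.1 x u
  have hshift : act A (x - xt) + act B (u - ut) = act A x + act B u - xt := by
    nth_rw 2 [← act_one_sub_sub_act_eq_zero_iff.1 h.steady]
    simp only [map_sub]
    abel
  have hdiss := hS.dissipation (x - xt) (u - ut)
  rw [hshift, quad_sub hS.posDef.1, quad_sub hS.posDef.1 (act A x + act B u)] at hdiss
  rw [inner_sub_right] at hcost
  rw [Cost.point, Cost.point, inner_sub_left, inner_sub_left, real_inner_smul_left,
    real_inner_smul_left, real_inner_comm x (act S xt),
    real_inner_comm (act A x + act B u) (act S xt)]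
  linarith

end SteadyState

section Riccati

variable {n l : ℕ} {A Q P P' : Matrix (Fin n) (Fin n) ℝ} {B : Matrix (Fin n) (Fin l) ℝ}
  {R : Matrix (Fin l) (Fin l) ℝ}

/-- The right-hand side of the discrete-time algebraic Riccati equation with weights `Q`, `R`: the
value function after one step of the Bellman recursion with terminal cost `‖x‖_P²`. -/
noncomputable def riccatiMap (A : Matrix (Fin n) (Fin n) ℝ) (B : Matrix (Fin n) (Fin l) ℝ)
    (Q : Matrix (Fin n) (Fin n) ℝ) (R : Matrix (Fin l) (Fin l) ℝ) (P : Matrix (Fin n) (Fin n) ℝ) :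
    Matrix (Fin n) (Fin n) ℝ :=
  Aᵀ * P * A + Q - Aᵀ * P * B * (R + Bᵀ * P * B)⁻¹ * Bᵀ * P * A

/-- The gain of the feedback that is optimal in the Bellman recursion with control weight `R` and
terminal cost `‖x‖_P²`. -/
noncomputable def riccatiGain (A : Matrix (Fin n) (Fin n) ℝ) (B : Matrix (Fin n) (Fin l) ℝ)
    (R : Matrix (Fin l) (Fin l) ℝ) (P : Matrix (Fin n) (Fin n) ℝ) : Matrix (Fin l) (Fin n) ℝ :=
  -((R + Bᵀ * P * B)⁻¹ * Bᵀ * P * A)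

theorem posDef_add_transpose_mul_mul (hR : R.PosDef) (hP : P.PosSemidef)
    (B : Matrix (Fin n) (Fin l) ℝ) : (R + Bᵀ * P * B).PosDef :=
  hR.add_posSemidef (hP.conjTranspose_mul_mul_same B)

theorem riccatiMap_eq_add_mul_closedLoop (A : Matrix (Fin n) (Fin n) ℝ)
    (B : Matrix (Fin n) (Fin l) ℝ) (Q : Matrix (Fin n) (Fin n) ℝ) (R : Matrix (Fin l) (Fin l) ℝ)
    (P : Matrix (Fin n) (Fin n) ℝ) :
    riccatiMap A B Q R P = Q + Aᵀ * P * (A + B * riccatiGain A B R P) := by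
  simp only [riccatiMap, riccatiGain, Matrix.mul_add, Matrix.mul_neg, Matrix.mul_assoc]
  abel

theorem mul_riccatiGain_add_mul_closedLoop (hR : R.PosDef) (hP : P.PosSemidef)
    (A : Matrix (Fin n) (Fin n) ℝ) (B : Matrix (Fin n) (Fin l) ℝ) :
    R * riccatiGain A B R P + Bᵀ * P * (A + B * riccatiGain A B R P) = 0 := by
  have hcancel : (R + Bᵀ * P * B) * riccatiGain A B R P = -(Bᵀ * P * A) := by
    have hunit := (Matrix.isUnit_iff_isUnit_det _).1 (posDef_add_transpose_mul_mul hR hP B).isUnit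
    rw [riccatiGain, Matrix.mul_neg, Matrix.mul_assoc _⁻¹ Bᵀ P, Matrix.mul_assoc _⁻¹ (Bᵀ * P) A,
      Matrix.mul_nonsing_inv_cancel_left _ _ hunit]
  rw [Matrix.add_mul, Matrix.mul_assoc (Bᵀ * P)] at hcancel
  rw [Matrix.mul_add, add_left_comm, hcancel, add_neg_cancel]

/-- The control direction `t` drops out on the right: along the optimal feedback the first variation
of the Bellman recursion vanishes. -/
theorem inner_riccatiMap (hR : R.PosDef) (hP : P.PosSemidef) (y : Vec n) (t : Vec l) (x : Vec n) :
    inner ℝ y (act Q x) + inner ℝ t (act R (act (riccatiGain A B R P) x))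
        + inner ℝ (act A y + act B t) (act P (act (A + B * riccatiGain A B R P) x))
      = inner ℝ y (act (riccatiMap A B Q R P) x) := by
  have hcontrol := mul_riccatiGain_add_mul_closedLoop hR hP A B
  set K := riccatiGain A B R P with hK
  have hvariation : inner ℝ t (act R (act K x)) + inner ℝ (act B t) (act P (act (A + B * K) x))
      = 0 := by
    rw [← Matrix.transpose_transpose B, ← inner_act, ← inner_add_right, Matrix.transpose_transpose,
      ← mul_act, ← mul_act, ← mul_act, ← add_act, hcontrol, zero_act, inner_zero_right]
  rw [riccatiMap_eq_add_mul_closedLoop, ← hK, add_act Q, mul_act, mul_act, inner_add_left,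
    inner_add_right, inner_act Aᵀ, Matrix.transpose_transpose]
  linarith

theorem quad_riccatiMap (hR : R.PosDef) (hP : P.PosSemidef) (x : Vec n) :
    quad (riccatiMap A B Q R P) x = quad Q x + quad R (act (riccatiGain A B R P) x)
      + quad P (act (A + B * riccatiGain A B R P) x) := by
  have h := inner_riccatiMap (Q := Q) hR hP x (act (riccatiGain A B R P) x) (A := A) (B := B) x
  rw [← mul_act B, ← add_act] at h
  exact h.symm

theorem quad_add_quad_add_quad_eq_riccatiMap (hR : R.PosDef) (hP : P.PosSemidef) (x : Vec n)
    (u : Vec l) :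
    quad Q x + quad R u + quad P (act A x + act B u) = quad (riccatiMap A B Q R P) x
      + quad (R + Bᵀ * P * B) (u - act (riccatiGain A B R P) x) := by
  obtain ⟨w, rfl⟩ : ∃ w, u = w + act (riccatiGain A B R P) x :=
    ⟨u - act (riccatiGain A B R P) x, (sub_add_cancel _ _).symm⟩
  have hvariation := inner_riccatiMap (A := A) (B := B) (Q := Q) hR hP 0 w x
  simp only [map_zero, inner_zero_left, zero_add] at hvariation
  have hstep : act A x + act B (w + act (riccatiGain A B R P) x)
      = act B w + act (A + B * riccatiGain A B R P) x := by
    simp only [map_add, add_act, mul_act]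
    abel
  rw [hstep, quad_add hR.1, quad_add hP.1, quad_riccatiMap hR hP, add_sub_cancel_right, add_quad,
    transpose_mul_mul_quad]
  linarith

theorem quad_riccatiMap_le (hR : R.PosDef) (hP : P.PosSemidef) (x : Vec n) (u : Vec l) :
    quad (riccatiMap A B Q R P) x ≤ quad Q x + quad R u + quad P (act A x + act B u) := by
  rw [quad_add_quad_add_quad_eq_riccatiMap hR hP, le_add_iff_nonneg_right]
  exact quad_nonneg (posDef_add_transpose_mul_mul hR hP B).posSemidef _

theorem isHermitian_riccatiMap (hQ : Q.IsHermitian) (hR : R.PosDef) (hP : P.PosSemidef) :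
    (riccatiMap A B Q R P).IsHermitian := by
  have hconj {a b : ℕ} {M : Matrix (Fin a) (Fin a) ℝ} (hM : M.IsHermitian)
      (N : Matrix (Fin a) (Fin b) ℝ) : (Nᵀ * M * N).IsHermitian :=
    Matrix.isHermitian_conjTranspose_mul_mul N hM
  have hsymm : Pᵀ = P := Matrix.isHermitian_iff_isSymm.1 hP.1
  have hform : riccatiMap A B Q R P
      = Aᵀ * P * A + Q - (Bᵀ * P * A)ᵀ * (R + Bᵀ * P * B)⁻¹ * (Bᵀ * P * A) := by
    simp only [riccatiMap, Matrix.transpose_mul, Matrix.transpose_transpose, hsymm,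
      Matrix.mul_assoc]
  rw [hform]
  exact ((hconj hP.1 A).add hQ).sub
    (hconj (posDef_add_transpose_mul_mul hR hP B).1.inv (Bᵀ * P * A))

theorem posSemidef_riccatiMap (hQ : Q.PosSemidef) (hR : R.PosDef) (hP : P.PosSemidef) :
    (riccatiMap A B Q R P).PosSemidef := by
  refine posSemidef_iff_quad.2 ⟨isHermitian_riccatiMap hQ.1 hR hP, fun x => ?_⟩
  rw [quad_riccatiMap hR hP]
  exact add_nonneg (add_nonneg (quad_nonneg hQ _) (quad_nonneg hR.posSemidef _))
    (quad_nonneg hP _)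

theorem riccatiMap_mono (hQ : Q.IsHermitian) (hR : R.PosDef) (hP : P.PosSemidef) (h : P ≤ P') :
    riccatiMap A B Q R P ≤ riccatiMap A B Q R P' := by
  have hP' : P'.PosSemidef := Matrix.nonneg_iff_posSemidef.1 (hP.nonneg.trans h)
  refine (le_iff_quad_le (isHermitian_riccatiMap hQ hR hP)
    (isHermitian_riccatiMap hQ hR hP')).2 fun x => ?_
  rw [quad_riccatiMap hR hP', add_act, mul_act]
  grw [quad_riccatiMap_le hR hP x (act (riccatiGain A B R P') x), quad_mono h]

theorem continuousAt_riccatiMap (hR : R.PosDef) (hP : P.PosSemidef) :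
    ContinuousAt (riccatiMap A B Q R) P := by
  have hinv : ContinuousAt (fun P : Matrix (Fin n) (Fin n) ℝ => (R + Bᵀ * P * B)⁻¹) P := by
    refine ContinuousAt.comp (g := Inv.inv) (continuousAt_matrix_inv _ ?_) (by fun_prop)
    rw [Ring.inverse_eq_inv']
    exact continuousAt_inv₀ (posDef_add_transpose_mul_mul hR hP B).det_pos.ne'
  unfold riccatiMap
  fun_prop

end Riccati

section LoewnerLimit

variable {d : ℕ} {M N : Matrix (Fin d) (Fin d) ℝ} {p : ℕ → Matrix (Fin d) (Fin d) ℝ}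

theorem continuous_quad_left (x : Vec d) :
    Continuous fun M : Matrix (Fin d) (Fin d) ℝ => quad M x := by
  simp only [quad_eq_dotProduct]
  fun_prop

theorem apply_eq_quad_polarization (hM : M.IsHermitian) (i j : Fin d) :
    M i j = (quad M (EuclideanSpace.single i 1 + EuclideanSpace.single j 1)
      - quad M (EuclideanSpace.single i 1 - EuclideanSpace.single j 1)) / 4 := by
  have hentry : M i j
      = inner ℝ (EuclideanSpace.single i (1 : ℝ)) (act M (EuclideanSpace.single j 1)) := by
    simp [act, EuclideanSpace.inner_single_left]
  rw [quad_add hM, quad_sub hM, hentry]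
  ring

theorem exists_tendsto_of_monotone_of_le (hp : ∀ k, (p k).IsHermitian) (hmono : Monotone p)
    (hle : ∀ k, p k ≤ N) : ∃ M, Tendsto p atTop (𝓝 M) := by
  have hquad (x : Vec d) : ∃ c, Tendsto (fun k => quad (p k) x) atTop (𝓝 c) :=
    ⟨_, tendsto_atTop_ciSup (fun i j hij => quad_mono (hmono hij) x)
      ⟨quad N x, Set.forall_mem_range.2 fun k => quad_mono (hle k) x⟩⟩
  choose c hc using hquad
  refine ⟨Matrix.of fun i j => (c (EuclideanSpace.single i 1 + EuclideanSpace.single j 1)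
      - c (EuclideanSpace.single i 1 - EuclideanSpace.single j 1)) / 4,
    tendsto_pi_nhds.2 fun i => tendsto_pi_nhds.2 fun j => ?_⟩
  simp only [apply_eq_quad_polarization (hp _) i j]
  exact ((hc _).sub (hc _)).div_const 4

theorem posSemidef_of_tendsto (hp : ∀ k, (p k).PosSemidef) (h : Tendsto p atTop (𝓝 M)) :
    M.PosSemidef := by
  have hsymm : Mᵀ = M := tendsto_nhds_unique ((continuous_id.matrix_transpose.tendsto M).comp h)
    (h.congr fun k => (Matrix.isHermitian_iff_isSymm.1 (hp k).1).symm)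
  exact posSemidef_iff_quad.2 ⟨Matrix.isHermitian_iff_isSymm.2 hsymm, fun x =>
    ge_of_tendsto' (((continuous_quad_left x).tendsto M).comp h) fun k => quad_nonneg (hp k) x⟩

end LoewnerLimit

section RiccatiEquation

variable {n l : ℕ} {A Q S P P' : Matrix (Fin n) (Fin n) ℝ} {B : Matrix (Fin n) (Fin l) ℝ}
  {R : Matrix (Fin l) (Fin l) ℝ} {r : ℝ}

theorem IsStabilizable.exists_riccatiMap_le (hAB : IsStabilizable A B) (hQ : Q.PosSemidef)
    (hR : R.PosDef) : ∃ V : Matrix (Fin n) (Fin n) ℝ, V.PosSemidef ∧ riccatiMap A B Q R V ≤ V := by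
  obtain ⟨F, hF⟩ := hAB
  obtain ⟨V, r, hV⟩ := exists_isLyapunov hF.tendsto_pow
  obtain ⟨c, hc, hcost⟩ := exists_quad_le
    (hQ.add (hR.posSemidef.conjTranspose_mul_mul_same F))
  have hr := hV.pos
  have hscaled : ((c / r) • V).PosSemidef := hV.posDef.posSemidef.smul (by positivity)
  refine ⟨(c / r) • V, hscaled,
    (le_iff_quad_le (isHermitian_riccatiMap hQ.1 hR hscaled) hscaled.1).2 fun x => ?_⟩
  calc quad (riccatiMap A B Q R ((c / r) • V)) x
      ≤ quad Q x + quad R (act F x) + quad ((c / r) • V) (act A x + act B (act F x)) :=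
        quad_riccatiMap_le hR hscaled x (act F x)
    _ = quad (Q + Fᵀ * R * F) x + c / r * quad V (act (A + B * F) x) := by
        rw [add_quad, transpose_mul_mul_quad, smul_quad, add_act, mul_act]
    _ ≤ c * ‖x‖ ^ 2 + c / r * (quad V x - r * ‖x‖ ^ 2) := by
        gcongr
        · exact hcost x
        · exact hV.decrease x
    _ = quad ((c / r) • V) x := by
        rw [smul_quad]
        field_simp
        ring

theorem IsStabilizable.exists_riccatiMap_eq (hAB : IsStabilizable A B) (hQ : Q.PosSemidef)
    (hR : R.PosDef) : ∃ P : Matrix (Fin n) (Fin n) ℝ, P.PosSemidef ∧ riccatiMap A B Q R P = P := by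
  obtain ⟨V, hV, hle⟩ := hAB.exists_riccatiMap_le hQ hR
  set p : ℕ → Matrix (Fin n) (Fin n) ℝ := fun k => (riccatiMap A B Q R)^[k] 0
  have hsucc (k : ℕ) : p (k + 1) = riccatiMap A B Q R (p k) :=
    Function.iterate_succ_apply' _ _ _
  have hp (k : ℕ) : (p k).PosSemidef := by
    induction k with
    | zero => exact .zero
    | succ k ih => exact hsucc k ▸ posSemidef_riccatiMap hQ hR ih
  have hmono : Monotone p := monotone_nat_of_le_succ fun k => by
    induction k with
    | zero => exact (hp 1).nonneg
    | succ k ih =>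
      rw [hsucc k, hsucc (k + 1)]
      exact riccatiMap_mono hQ.1 hR (hp k) ih
  have hbound (k : ℕ) : p k ≤ V := by
    induction k with
    | zero => exact hV.nonneg
    | succ k ih => exact hsucc k ▸ (riccatiMap_mono hQ.1 hR (hp k) ih).trans hle
  obtain ⟨P, hlim⟩ := exists_tendsto_of_monotone_of_le (fun k => (hp k).1) hmono hbound
  have hP := posSemidef_of_tendsto hp hlim
  refine ⟨P, hP, tendsto_nhds_unique ?_ (hlim.comp (tendsto_add_atTop_nat 1))⟩
  exact ((continuousAt_riccatiMap hR hP).tendsto.comp hlim).congr fun k => (hsucc k).symm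

theorem IsStrictStorage.isLyapunov_closedLoop (hS : IsStrictStorage A B Q R S r) (hR : R.PosDef)
    (hP : P.PosSemidef) (hfix : riccatiMap A B Q R P = P) :
    IsLyapunov (P + S) (A + B * riccatiGain A B R P) r where
  posDef := hS.posDef.posSemidef_add hP
  pos := hS.pos
  decrease x := by
    have hvalue := quad_riccatiMap (A := A) (B := B) (Q := Q) hR hP x
    have hdiss := hS.dissipation x (act (riccatiGain A B R P) x)
    rw [hfix] at hvalue
    rw [← mul_act, ← add_act] at hdiss
    rw [add_quad, add_quad]
    linarith

theorem quad_le_of_riccatiMap_eq (hR : R.PosDef) (hP : P.PosSemidef)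
    (hfix : riccatiMap A B Q R P = P) (hP' : P'.PosSemidef) (hfix' : riccatiMap A B Q R P' = P')
    (hstable : Tendsto (fun k => (A + B * riccatiGain A B R P') ^ k) atTop (𝓝 0)) (x : Vec n) :
    quad P x ≤ quad P' x := by
  set M := A + B * riccatiGain A B R P'
  have hstep (x : Vec n) : quad P x - quad P' x ≤ quad P (act M x) - quad P' (act M x) := by
    have hvalue' := quad_riccatiMap (A := A) (B := B) (Q := Q) hR hP' x
    have hvalue := quad_riccatiMap_le (A := A) (B := B) (Q := Q) hR hP x
      (act (riccatiGain A B R P') x)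
    rw [hfix'] at hvalue'
    rw [hfix, ← mul_act, ← add_act] at hvalue
    linarith
  have hpow (k : ℕ) : quad P x - quad P' x ≤ quad P (act (M ^ k) x) := by
    suffices quad P x - quad P' x ≤ quad P (act (M ^ k) x) - quad P' (act (M ^ k) x) by
      linarith [quad_nonneg hP' (act (M ^ k) x)]
    induction k with
    | zero => rw [pow_zero, one_act]
    | succ k ih =>
      rw [pow_succ', mul_act]
      exact ih.trans (hstep _)
  have hlim : Tendsto (fun k => quad P (act (M ^ k) x)) atTop (𝓝 0) := by
    have hcont : Continuous (quad P) := continuous_id.inner (continuous_act P)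
    refine (hcont.tendsto' 0 0 ?_).comp (tendsto_act_pow hstable x)
    rw [quad, inner_zero_left]
  exact sub_nonpos.1 (ge_of_tendsto' hlim hpow)

theorem IsStrictStorage.riccatiMap_fixedPoint_unique (hS : IsStrictStorage A B Q R S r)
    (hR : R.PosDef) (hP : P.PosSemidef) (hfix : riccatiMap A B Q R P = P) (hP' : P'.PosSemidef)
    (hfix' : riccatiMap A B Q R P' = P') : P' = P :=
  le_antisymm
    ((le_iff_quad_le hP'.1 hP.1).2 (quad_le_of_riccatiMap_eq hR hP' hfix' hP hfix
      (hS.isLyapunov_closedLoop hR hP hfix).tendsto_pow))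
    ((le_iff_quad_le hP.1 hP'.1).2 (quad_le_of_riccatiMap_eq hR hP hfix hP' hfix'
      (hS.isLyapunov_closedLoop hR hP' hfix').tendsto_pow))

end RiccatiEquation

section LpFixedPoint

theorem isUnit_one_sub_of_tendsto_pow {R : Type*} [NormedRing R] [CompleteSpace R] {a : R}
    (h : Tendsto (fun k : ℕ => a ^ k) atTop (𝓝 0)) : IsUnit (1 - a) := by
  have hnorm := h.norm
  rw [norm_zero] at hnorm
  obtain ⟨N, hN⟩ := (hnorm.eventually_lt_const one_pos).exists
  have hcomm : Commute (1 - a) (∑ i ∈ Finset.range N, a ^ i) :=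
    .sum_right _ _ _ fun i _ => ((Commute.one_left a).sub_left (Commute.refl a)).pow_right i
  refine (hcomm.isUnit_mul_iff.1 ?_).1
  rw [mul_neg_geom_sum]
  exact isUnit_one_sub_of_norm_lt_one hN

variable {Ω E : Type*} [MeasurableSpace Ω] {ν : Measure Ω} [NormedAddCommGroup E] [NormedSpace ℝ E]
  {p : ENNReal} [Fact (1 ≤ p)] {σ : Ω → Ω}

/-- The weighted Koopman operator `f ↦ L ∘ f ∘ σ` on `Lᵖ`. -/
noncomputable def weightedKoopman (p : ENNReal) [Fact (1 ≤ p)] (L : E →L[ℝ] E)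
    (hσ : MeasurePreserving σ ν ν) : Lp E p ν →L[ℝ] Lp E p ν :=
  (L.compLpL p ν).comp (Lp.compMeasurePreservingₗᵢ ℝ σ hσ).toContinuousLinearMap

theorem coeFn_weightedKoopman (L : E →L[ℝ] E) (hσ : MeasurePreserving σ ν ν) (f : Lp E p ν) :
    weightedKoopman p L hσ f =ᵐ[ν] fun a => L (f (σ a)) :=
  (L.coeFn_compLpL _).trans ((Lp.coeFn_compMeasurePreserving f hσ).fun_comp L)

theorem weightedKoopman_pow (L : E →L[ℝ] E) (hσ : MeasurePreserving σ ν ν) (k : ℕ) :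
    weightedKoopman p L hσ ^ k = weightedKoopman p (L ^ k) (hσ.iterate k) := by
  refine ContinuousLinearMap.ext fun f => Lp.ext ?_
  induction k generalizing f with
  | zero =>
    rw [pow_zero, pow_zero]
    exact (coeFn_weightedKoopman 1 (hσ.iterate 0) f).symm
  | succ k ih =>
    rw [pow_succ]
    filter_upwards [ih (weightedKoopman p L hσ f),
      coeFn_weightedKoopman (L ^ k) (hσ.iterate k) (weightedKoopman p L hσ f),
      (hσ.iterate k).quasiMeasurePreserving.ae (coeFn_weightedKoopman L hσ f),
      coeFn_weightedKoopman (L ^ (k + 1)) (hσ.iterate (k + 1)) f] with a hind hk hstep hsucc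
    rw [hsucc, Function.iterate_succ_apply', pow_succ]
    exact hind.trans (hk.trans (congrArg (L ^ k) hstep))

theorem norm_weightedKoopman_le (L : E →L[ℝ] E) (hσ : MeasurePreserving σ ν ν) :
    ‖weightedKoopman p L hσ‖ ≤ ‖L‖ :=
  ContinuousLinearMap.opNorm_le_bound _ (norm_nonneg L) fun f =>
    (L.norm_compLp_le _).trans_eq (congrArg (‖L‖ * ·) (Lp.norm_compMeasurePreserving f hσ))

theorem exists_memLp_eq_apply_comp_add [CompleteSpace E] {L : E →L[ℝ] E}
    (hL : Tendsto (fun k : ℕ => L ^ k) atTop (𝓝 0)) (hσ : MeasurePreserving σ ν ν) {g : Ω → E}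
    (hg : MemLp g p ν) :
    ∃ Z : Ω → E, StronglyMeasurable Z ∧ MemLp Z p ν ∧ Z =ᵐ[ν] fun a => L (Z (σ a)) + g a := by
  have hunit : IsUnit (1 - weightedKoopman p L hσ) := by
    refine isUnit_one_sub_of_tendsto_pow (squeeze_zero_norm (fun k => ?_)
      (tendsto_zero_iff_norm_tendsto_zero.1 hL))
    rw [weightedKoopman_pow]
    exact norm_weightedKoopman_le _ _
  obtain ⟨T, hT⟩ := hunit.exists_right_inv
  set Z := T (hg.toLp g)
  have hfix : Z = weightedKoopman p L hσ Z + hg.toLp g := by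
    have := DFunLike.congr_fun hT (hg.toLp g)
    exact sub_eq_iff_eq_add'.1 this
  refine ⟨Z, Lp.stronglyMeasurable Z, Lp.memLp Z, ?_⟩
  filter_upwards [Lp.coeFn_add (weightedKoopman p L hσ Z) (hg.toLp g), hg.coeFn_toLp,
    coeFn_weightedKoopman L hσ Z] with a hadd hga hKa
  rw [← hga, ← hKa, ← Pi.add_apply, ← hadd, ← hfix]

end LpFixedPoint

section Stationarity

variable {Ω S N : Type*}

/-- The skew product over the shift of noise sequences: the state moves along the first entry of
the noise sequence, which is then dropped. -/
def skewProduct (G : S × N → S) (p : S × (ℕ → N)) : S × (ℕ → N) :=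
  (G (p.1, p.2 0), fun j => p.2 (j + 1))

/-- The state process of the recursion `X (k + 1) = G (X k, W k)` with initial value `X₀`. -/
def trajectory (G : S × N → S) (X₀ : Ω → S) (W : ℕ → Ω → N) : ℕ → Ω → S
  | 0 => X₀
  | k + 1 => fun ω => G (trajectory G X₀ W k ω, W k ω)

theorem iterate_skewProduct (G : S × N → S) (X₀ : Ω → S) (W : ℕ → Ω → N) (k : ℕ) (ω : Ω) :
    (skewProduct G)^[k] (X₀ ω, fun j => W j ω)
      = (trajectory G X₀ W k ω, fun j => W (j + k) ω) := by
  induction k with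
  | zero => rfl
  | succ k ih =>
    rw [Function.iterate_succ_apply', ih, skewProduct, trajectory]
    simp only [zero_add, add_assoc, add_comm 1 k]

variable [MeasurableSpace Ω] [MeasurableSpace S] [MeasurableSpace N]
  {μ : Measure Ω} {ρ : Measure S} {τ : Measure N}

theorem indepFun_zero_succ {W : ℕ → Ω → N} (hmeas : ∀ k, Measurable (W k)) (h : iIndepFun W μ) :
    IndepFun (W 0) (fun ω j => W (j + 1) ω) μ := by
  have hdisj : Disjoint ({0} : Set ℕ) {i | 0 < i} := by simp
  rw [IndepFun_iff_Indep]
  refine indep_of_indep_of_le_left (indep_of_indep_of_le_right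
    (indep_iSup_of_disjoint (fun i => (hmeas i).comap_le) h.iIndep hdisj) ?_) ?_
  · rw [MeasurableSpace.pi, MeasurableSpace.comap_iSup]
    refine iSup_le fun j => ?_
    rw [MeasurableSpace.comap_comp]
    exact le_iSup₂_of_le (j + 1) j.succ_pos le_rfl
  · exact le_iSup₂_of_le 0 rfl le_rfl

theorem measurePreserving_succ_infinitePi [IsProbabilityMeasure τ] :
    MeasurePreserving (fun (w : ℕ → N) j => w (j + 1)) (Measure.infinitePi fun _ => τ)
      (Measure.infinitePi fun _ => τ) :=
  ⟨by fun_prop, Measure.map_infinitePi_infinitePi_of_inj (P := fun _ : ℕ => τ)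
    (f := (· + 1)) (add_left_injective 1)⟩

theorem measurePreserving_zero_succ_infinitePi [IsProbabilityMeasure τ] :
    MeasurePreserving (fun w : ℕ → N => (w 0, fun j => w (j + 1))) (Measure.infinitePi fun _ => τ)
      (τ.prod (Measure.infinitePi fun _ => τ)) := by
  have hindep := indepFun_zero_succ (W := fun k (w : ℕ → N) => w k) (fun k => by fun_prop)
    (iIndepFun_infinitePi (P := fun _ => τ) (X := fun _ => id) fun _ => measurable_id)
  exact ⟨by fun_prop, (hindep.hasLaw_prod
    (measurePreserving_eval_infinitePi (fun _ : ℕ => τ) 0).hasLaw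
    measurePreserving_succ_infinitePi.hasLaw).map_eq⟩

theorem measurePreserving_skewProduct [SFinite ρ] [IsProbabilityMeasure τ] {G : S × N → S}
    (hG : MeasurePreserving G (ρ.prod τ) ρ) :
    MeasurePreserving (skewProduct G) (ρ.prod (Measure.infinitePi fun _ => τ))
      (ρ.prod (Measure.infinitePi fun _ => τ)) :=
  ((hG.prod (MeasurePreserving.id _)).comp (measurePreserving_prodAssoc _ _ _).symm).comp
    ((MeasurePreserving.id ρ).prod measurePreserving_zero_succ_infinitePi)

theorem hasLaw_trajectory [SFinite ρ] [IsProbabilityMeasure τ] {G : S × N → S} {X₀ : Ω → S}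
    {W : ℕ → Ω → N} (hG : MeasurePreserving G (ρ.prod τ) ρ)
    (hlaw : HasLaw (fun ω => (X₀ ω, fun j => W j ω)) (ρ.prod (Measure.infinitePi fun _ => τ)) μ)
    (k : ℕ) : HasLaw (fun ω => (trajectory G X₀ W k ω, W k ω)) (ρ.prod τ) μ := by
  have hiterate := ((measurePreserving_skewProduct hG).iterate k).hasLaw.comp hlaw
  have heval := ((MeasurePreserving.id ρ).prod
    (measurePreserving_eval_infinitePi (fun _ : ℕ => τ) 0)).hasLaw.comp hiterate
  refine heval.congr (.of_forall fun ω => ?_)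
  simp only [Function.comp_apply, iterate_skewProduct, Prod.map_apply, id, Function.eval, zero_add]

theorem exists_measurePreserving_affine {E : Type*} [NormedAddCommGroup E] [NormedSpace ℝ E]
    [CompleteSpace E] [SecondCountableTopology E] [MeasurableSpace E] [BorelSpace E]
    {p : ENNReal} [Fact (1 ≤ p)] [IsProbabilityMeasure τ] {L : E →L[ℝ] E}
    (hL : Tendsto (fun k : ℕ => L ^ k) atTop (𝓝 0)) {b : N → E} (hbm : Measurable b)
    (hb : MemLp b p τ) :
    ∃ ρ : Measure E, IsProbabilityMeasure ρ ∧ MemLp id p ρ ∧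
      MeasurePreserving (fun q : E × N => L q.1 + b q.2) (ρ.prod τ) ρ := by
  set ν : Measure (ℕ → N) := Measure.infinitePi fun _ => τ
  have hbν : MemLp (fun w : ℕ → N => b (w 0)) p ν :=
    hb.comp_measurePreserving (measurePreserving_eval_infinitePi (fun _ : ℕ => τ) 0)
  obtain ⟨Z, hZm, hZp, hZ⟩ :=
    exists_memLp_eq_apply_comp_add hL measurePreserving_succ_infinitePi hbν
  have hZmap : MeasurePreserving Z ν (ν.map Z) := hZm.measurable.measurePreserving ν
  have hpair : MeasurePreserving (fun w : ℕ → N => (Z fun j => w (j + 1), w 0)) ν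
      ((ν.map Z).prod τ) :=
    (hZmap.prod (MeasurePreserving.id τ)).comp
      (Measure.measurePreserving_swap.comp measurePreserving_zero_succ_infinitePi)
  have := Measure.isProbabilityMeasure_map (μ := ν) hZm.measurable.aemeasurable
  refine ⟨ν.map Z, this, ?_, by fun_prop, ?_⟩
  · exact (memLp_map_measure_iff aestronglyMeasurable_id hZm.measurable.aemeasurable).2 hZp
  · rw [← hpair.map_eq, Measure.map_map (by fun_prop) hpair.measurable]
    exact Measure.map_congr hZ.symm

end Stationarity

section Expectation

variable {Ω : Type*} [MeasurableSpace Ω] {μ : Measure Ω} {a b d : ℕ}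

theorem memLp_act {p : ENNReal} (M : Matrix (Fin a) (Fin b) ℝ) {X : Ω → Vec b}
    (hX : MemLp X p μ) : MemLp (fun ω => act M (X ω)) p μ :=
  (Matrix.toEuclideanLin M).toContinuousLinearMap.comp_memLp' hX

theorem integrable_act (M : Matrix (Fin a) (Fin b) ℝ) {X : Ω → Vec b} (hX : Integrable X μ) :
    Integrable (fun ω => act M (X ω)) μ :=
  (Matrix.toEuclideanLin M).toContinuousLinearMap.integrable_comp hX

theorem integral_act (M : Matrix (Fin a) (Fin b) ℝ) {X : Ω → Vec b} (hX : Integrable X μ) :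
    ∫ ω, act M (X ω) ∂μ = act M (∫ ω, X ω ∂μ) :=
  (Matrix.toEuclideanLin M).toContinuousLinearMap.integral_comp_comm hX

theorem integrable_inner {E : Type*} [NormedAddCommGroup E] [InnerProductSpace ℝ E] {X Y : Ω → E}
    (hX : MemLp X 2 μ) (hY : MemLp Y 2 μ) : Integrable (fun ω => inner ℝ (X ω) (Y ω)) μ :=
  (hX.norm.integrable_mul hY.norm).mono' (hX.1.inner hY.1)
    (ae_of_all _ fun ω => norm_inner_le_norm (X ω) (Y ω))

theorem integrable_quad (M : Matrix (Fin d) (Fin d) ℝ) {X : Ω → Vec d} (hX : MemLp X 2 μ) :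
    Integrable (fun ω => quad M (X ω)) μ :=
  integrable_inner hX (memLp_act M hX)

theorem integral_quad_add {M : Matrix (Fin d) (Fin d) ℝ} (hM : M.IsHermitian) {X Z : Ω → Vec d}
    (hX : MemLp X 2 μ) (hZ : MemLp Z 2 μ) :
    ∫ ω, quad M (X ω + Z ω) ∂μ = ∫ ω, quad M (X ω) ∂μ
      + 2 * ∫ ω, inner ℝ (X ω) (act M (Z ω)) ∂μ + ∫ ω, quad M (Z ω) ∂μ := by
  have hquad := integrable_quad M hX
  have hcross := (integrable_inner hX (memLp_act M hZ)).const_mul 2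
  simp only [quad_add hM]
  rw [integral_add (by exact hquad.add hcross) (integrable_quad M hZ), integral_add hquad hcross,
    integral_const_mul]

theorem integral_inner_act_eq_zero_of_indepFun (M : Matrix (Fin a) (Fin b) ℝ) {X : Ω → Vec a}
    {N : Ω → Vec b} (hX : Integrable X μ) (hN : Integrable N μ) (h : IndepFun X N μ)
    (hN0 : ∫ ω, N ω ∂μ = 0) : ∫ ω, inner ℝ (X ω) (act M (N ω)) ∂μ = 0 := by
  have hindep : IndepFun X (fun ω => act M (N ω)) μ :=
    h.comp measurable_id (continuous_act M).measurable
  have hprod : ∫ ω, inner ℝ (X ω) (act M (N ω)) ∂μ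
      = inner ℝ (∫ ω, X ω ∂μ) (∫ ω, act M (N ω) ∂μ) :=
    hindep.integral_bilin hX (integrable_act M hN) (innerSL ℝ)
  simp only [hprod, integral_act M hN, hN0, map_zero, inner_zero_right]

theorem integral_inner_const_act_of_centered (M : Matrix (Fin a) (Fin b) ℝ) (x : Vec a)
    {Z : Ω → Vec b} (hZ : Integrable Z μ) (hZ0 : ∫ ω, Z ω ∂μ = 0) :
    ∫ ω, inner ℝ x (act M (Z ω)) ∂μ = 0 := by
  simp only [integral_inner (integrable_act M hZ), integral_act M hZ, hZ0, map_zero,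
    inner_zero_right]

variable [IsFiniteMeasure μ]

theorem integrable_inner_const (q : Vec d) {X : Ω → Vec d} (hX : MemLp X 2 μ) :
    Integrable (fun ω => inner ℝ q (X ω)) μ :=
  (hX.const_inner q).integrable one_le_two

theorem trace_mul_covMat (Q : Matrix (Fin d) (Fin d) ℝ) {X : Ω → Vec d} (hX : MemLp X 2 μ) :
    (Q * covMat μ X).trace = ∫ ω, quad Q (X ω - ∫ ω', X ω' ∂μ) ∂μ := by
  set m := ∫ ω, X ω ∂μ
  have hcoord (i : Fin d) : MemLp (fun ω => X ω i - m i) 2 μ :=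
    (EuclideanSpace.proj (𝕜 := ℝ) i).comp_memLp' (hX.sub (memLp_const m))
  have hmean (i : Fin d) : ∫ ω, X ω i ∂μ = m i :=
    (EuclideanSpace.proj (𝕜 := ℝ) i).integral_comp_comm (hX.integrable one_le_two)
  have hprod (i j : Fin d) :
      Integrable (fun ω => Q i j * ((X ω j - m j) * (X ω i - m i))) μ :=
    ((hcoord j).integrable_mul (hcoord i)).const_mul _
  have hquad (x : Vec d) : quad Q x = ∑ i, ∑ j, Q i j * (x j * x i) := by
    rw [quad_eq_dotProduct]
    simp only [dotProduct, Matrix.mulVec, Finset.mul_sum]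
    exact Finset.sum_congr rfl fun i _ => Finset.sum_congr rfl fun j _ => by
      rw [Pi.star_apply, star_trivial]; ring
  simp only [hquad, PiLp.sub_apply, Matrix.trace, Matrix.diag_apply, Matrix.mul_apply]
  rw [integral_finsetSum _ fun i _ => integrable_finsetSum _ fun j _ => hprod i j]
  refine Finset.sum_congr rfl fun i _ => ?_
  rw [integral_finsetSum _ fun j _ => hprod i j]
  refine Finset.sum_congr rfl fun j _ => ?_
  rw [integral_const_mul, covMat, Matrix.of_apply, covariance, hmean, hmean]

theorem trace_mul_covMat_nonneg {Q : Matrix (Fin d) (Fin d) ℝ} (hQ : Q.PosSemidef)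
    {X : Ω → Vec d} (hX : MemLp X 2 μ) : 0 ≤ (Q * covMat μ X).trace := by
  rw [trace_mul_covMat Q hX]
  exact integral_nonneg fun ω => quad_nonneg hQ _

end Expectation

section Cost

variable {Ω : Type*} [MeasurableSpace Ω] {μ : Measure Ω} [IsProbabilityMeasure μ] {d : ℕ}

theorem covMat_const (x : Vec d) : covMat μ (fun _ => x) = 0 := by
  ext i j
  exact covariance_const_left (x i)

theorem covMat_add_const {X : Ω → Vec d} (hX : Integrable X μ) (x : Vec d) :
    covMat μ (fun ω => X ω + x) = covMat μ X := by
  have hcoord (i : Fin d) : Integrable (fun ω => X ω i) μ :=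
    (EuclideanSpace.proj (𝕜 := ℝ) i).integrable_comp hX
  ext i j
  simp only [covMat, Matrix.of_apply, PiLp.add_apply]
  rw [covariance_add_const_left (hcoord i), covariance_add_const_right (hcoord j)]

theorem trace_mul_covMat_add_centered {Q : Matrix (Fin d) (Fin d) ℝ} (hQ : Q.IsHermitian)
    {X Z : Ω → Vec d} (hX : MemLp X 2 μ) (hZ : MemLp Z 2 μ) (hZ0 : ∫ ω, Z ω ∂μ = 0) :
    (Q * covMat μ (fun ω => X ω + Z ω)).trace = (Q * covMat μ X).trace
      + 2 * ∫ ω, inner ℝ (X ω) (act Q (Z ω)) ∂μ + ∫ ω, quad Q (Z ω) ∂μ := by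
  have hXint := hX.integrable one_le_two
  have hZint := hZ.integrable one_le_two
  have hQZ := memLp_act Q hZ
  have hmean : ∫ ω, (X ω + Z ω) ∂μ = ∫ ω, X ω ∂μ := by
    rw [integral_add hXint hZint, hZ0, add_zero]
  have hcross : ∫ ω, inner ℝ (X ω - ∫ ω', X ω' ∂μ) (act Q (Z ω)) ∂μ
      = ∫ ω, inner ℝ (X ω) (act Q (Z ω)) ∂μ := by
    simp only [inner_sub_left]
    rw [integral_sub (integrable_inner hX hQZ) (integrable_inner_const _ hQZ),
      integral_inner (hQZ.integrable one_le_two), integral_act Q hZint, hZ0]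
    simp only [map_zero, inner_zero_right, sub_zero]
  rw [trace_mul_covMat Q hX, trace_mul_covMat Q (by exact hX.add hZ), hmean, ← hcross,
    ← integral_quad_add hQ (by exact hX.sub (memLp_const _)) hZ]
  simp only [sub_add_eq_add_sub]

theorem integral_quad_add_trace_mul_covMat_add_centered {Q R : Matrix (Fin d) (Fin d) ℝ}
    (hQ : Q.IsHermitian) (hR : R.IsHermitian) {X Z : Ω → Vec d} (hX : MemLp X 2 μ)
    (hZ : MemLp Z 2 μ) (hZ0 : ∫ ω, Z ω ∂μ = 0) :
    ∫ ω, quad Q (X ω + Z ω) ∂μ + (R * covMat μ (fun ω => X ω + Z ω)).trace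
      = ∫ ω, quad Q (X ω) ∂μ + (R * covMat μ X).trace
        + 2 * ∫ ω, inner ℝ (X ω) (act (Q + R) (Z ω)) ∂μ + ∫ ω, quad (Q + R) (Z ω) ∂μ := by
  simp only [add_act, inner_add_right, add_quad]
  rw [integral_quad_add hQ hX hZ, trace_mul_covMat_add_centered hR hX hZ hZ0,
    integral_add (integrable_inner hX (memLp_act Q hZ)) (integrable_inner hX (memLp_act R hZ)),
    integral_add (integrable_quad Q hZ) (integrable_quad R hZ)]
  ring

variable {n l : ℕ} (C : Cost n l)

theorem Cost.integrable_point {X : Ω → Vec n} {U : Ω → Vec l} (hX : MemLp X 2 μ)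
    (hU : MemLp U 2 μ) : Integrable (fun ω => C.point (X ω) (U ω)) μ :=
  ((((integrable_quad C.Q₁ hX).add (integrable_quad C.R₁ hU)).add
    (integrable_inner_const C.s hX)).add (integrable_inner_const C.v hU)).add (integrable_const _)

theorem Cost.ell_const (x : Vec n) (u : Vec l) :
    C.ell μ (fun _ => x) (fun _ => u) = C.point x u := by
  simp only [Cost.ell, Cost.point, covMat_const, mul_zero, Matrix.trace_zero, add_zero,
    integral_const, probReal_univ, one_smul]

theorem Cost.point_shift (hQ : C.Q₁.IsHermitian) (hR : C.R₁.IsHermitian) (xs x : Vec n)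
    (us u : Vec l) : (C.shift xs us).point x u = C.point (x + xs) (u + us) := by
  simp only [Cost.point, Cost.shift, quad_add hQ, quad_add hR, inner_add_right, inner_add_left,
    real_inner_smul_left, real_inner_comm x (act C.Q₁ xs), real_inner_comm u (act C.R₁ us)]
  ring

theorem Cost.ell_shift (hQ : C.Q₁.IsHermitian) (hR : C.R₁.IsHermitian) (xs : Vec n) (us : Vec l)
    {X : Ω → Vec n} {U : Ω → Vec l} (hX : Integrable X μ) (hU : Integrable U μ) :
    (C.shift xs us).ell μ X U = C.ell μ (fun ω => X ω + xs) (fun ω => U ω + us) := by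
  have hpoint : ∫ ω, (C.shift xs us).point (X ω) (U ω) ∂μ
      = ∫ ω, C.point (X ω + xs) (U ω + us) ∂μ := by simp only [C.point_shift hQ hR]
  rw [Cost.ell, Cost.ell, covMat_add_const hX, covMat_add_const hU]
  exact congrArg (· + _ + _) hpoint

theorem Cost.ell_eq {X : Ω → Vec n} {U : Ω → Vec l} (hX : MemLp X 2 μ) (hU : MemLp U 2 μ) :
    C.ell μ X U = (∫ ω, quad C.Q₁ (X ω) ∂μ + (C.Q₂ * covMat μ X).trace)
      + (∫ ω, quad C.R₁ (U ω) ∂μ + (C.R₂ * covMat μ U).trace)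
      + inner ℝ C.s (∫ ω, X ω ∂μ) + inner ℝ C.v (∫ ω, U ω ∂μ) + C.c := by
  have hquadX := integrable_quad C.Q₁ hX
  have hquadU := integrable_quad C.R₁ hU
  have hinnerX := integrable_inner_const C.s hX
  have hinnerU := integrable_inner_const C.v hU
  rw [Cost.ell,
    integral_add (by exact ((hquadX.add hquadU).add hinnerX).add hinnerU) (integrable_const _),
    integral_add (by exact (hquadX.add hquadU).add hinnerX) hinnerU,
    integral_add (by exact hquadX.add hquadU) hinnerX, integral_add hquadX hquadU,
    integral_inner (hX.integrable one_le_two), integral_inner (hU.integrable one_le_two),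
    integral_const, probReal_univ, one_smul]
  ring

theorem Cost.ell_add_centered (hQ₁ : C.Q₁.IsHermitian) (hQ₂ : C.Q₂.IsHermitian)
    (hR₁ : C.R₁.IsHermitian) (hR₂ : C.R₂.IsHermitian) {X Z : Ω → Vec n} {U V : Ω → Vec l}
    (hX : MemLp X 2 μ) (hU : MemLp U 2 μ) (hZ : MemLp Z 2 μ) (hV : MemLp V 2 μ)
    (hZ0 : ∫ ω, Z ω ∂μ = 0) (hV0 : ∫ ω, V ω ∂μ = 0) :
    C.ell μ (fun ω => X ω + Z ω) (fun ω => U ω + V ω) = C.ell μ X U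
      + 2 * ∫ ω, inner ℝ (X ω) (act (C.Q₁ + C.Q₂) (Z ω)) ∂μ + ∫ ω, quad (C.Q₁ + C.Q₂) (Z ω) ∂μ
      + 2 * ∫ ω, inner ℝ (U ω) (act (C.R₁ + C.R₂) (V ω)) ∂μ
      + ∫ ω, quad (C.R₁ + C.R₂) (V ω) ∂μ := by
  rw [C.ell_eq (by exact hX.add hZ) (by exact hU.add hV), C.ell_eq hX hU,
    integral_quad_add_trace_mul_covMat_add_centered hQ₁ hQ₂ hX hZ hZ0,
    integral_quad_add_trace_mul_covMat_add_centered hR₁ hR₂ hU hV hV0,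
    integral_add (hX.integrable one_le_two) (hZ.integrable one_le_two), hZ0, add_zero,
    integral_add (hU.integrable one_le_two) (hV.integrable one_le_two), hV0, add_zero]
  ring

theorem Cost.ell_add_centered_sub_ell_add_centered (hQ₁ : C.Q₁.IsHermitian)
    (hQ₂ : C.Q₂.IsHermitian) (hR₁ : C.R₁.IsHermitian) (hR₂ : C.R₂.IsHermitian) (x : Vec n)
    (u : Vec l) {X Z : Ω → Vec n} {U V : Ω → Vec l} (hX : MemLp X 2 μ) (hU : MemLp U 2 μ)
    (hZ : MemLp Z 2 μ) (hV : MemLp V 2 μ) (hZ0 : ∫ ω, Z ω ∂μ = 0) (hV0 : ∫ ω, V ω ∂μ = 0) :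
    C.ell μ (fun ω => X ω + Z ω) (fun ω => U ω + V ω)
        - C.ell μ (fun ω => x + Z ω) (fun ω => u + V ω)
      = C.ell μ X U - C.ell μ (fun _ => x) (fun _ => u)
        + 2 * ∫ ω, inner ℝ (X ω) (act (C.Q₁ + C.Q₂) (Z ω)) ∂μ
        + 2 * ∫ ω, inner ℝ (U ω) (act (C.R₁ + C.R₂) (V ω)) ∂μ := by
  rw [C.ell_add_centered hQ₁ hQ₂ hR₁ hR₂ hX hU hZ hV hZ0 hV0,
    C.ell_add_centered hQ₁ hQ₂ hR₁ hR₂ (memLp_const x) (memLp_const u) hZ hV hZ0 hV0,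
    integral_inner_const_act_of_centered _ x (hZ.integrable one_le_two) hZ0,
    integral_inner_const_act_of_centered _ u (hV.integrable one_le_two) hV0]
  ring

end Cost

section SquareIntegrable

variable {Ω : Type*} [MeasurableSpace Ω] {μ : Measure Ω} {d : ℕ}

theorem isP2_iff {ρ : Measure (Vec d)} : IsP2 ρ ↔ IsProbabilityMeasure ρ ∧ MemLp id 2 ρ :=
  ⟨fun h => ⟨h.isProbabilityMeasure,
    (memLp_two_iff_integrable_sq_norm aestronglyMeasurable_id).2 h.integrable_sq⟩,
  fun h => ⟨h.1, (memLp_two_iff_integrable_sq_norm aestronglyMeasurable_id).1 h.2⟩⟩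

theorem isP2_map [IsProbabilityMeasure μ] {X : Ω → Vec d} (hX : MemLp X 2 μ) : IsP2 (μ.map X) :=
  isP2_iff.2 ⟨Measure.isProbabilityMeasure_map hX.1.aemeasurable,
    (memLp_map_measure_iff aestronglyMeasurable_id hX.1.aemeasurable).2 hX⟩

theorem IsP2.memLp_of_hasLaw {ρ : Measure (Vec d)} (h : IsP2 ρ) {X : Ω → Vec d}
    (hX : HasLaw X ρ μ) : MemLp X 2 μ := by
  rw [isP2_iff, ← hX.map_eq, memLp_map_measure_iff aestronglyMeasurable_id hX.aemeasurable] at h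
  exact h.2

theorem integral_sub_mean_eq_zero [IsProbabilityMeasure μ] {ρ : Measure (Vec d)} (h : IsP2 ρ)
    {X : Ω → Vec d} (hX : HasLaw X ρ μ) : ∫ ω, (X ω - ∫ x, x ∂ρ) ∂μ = 0 := by
  rw [integral_sub ((h.memLp_of_hasLaw hX).integrable one_le_two) (integrable_const _),
    hX.integral_eq, integral_const, probReal_univ, one_smul, sub_self]

end SquareIntegrable

section ErrorSystem

variable {n l m : ℕ} {D : Dynamics n l m} {C : Cost n l}

theorem isRiccatiSolution_iff {P : Matrix (Fin n) (Fin n) ℝ} : IsRiccatiSolution D C P ↔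
    P.PosSemidef ∧ riccatiMap D.A D.B (C.Q₁ + C.Q₂) (C.R₁ + C.R₂) P = P :=
  and_congr_right fun _ => eq_comm

theorem isClassKInfty_mul_left {r : ℝ} (hr : 0 < r) : IsClassKInfty (fun t => r * t) where
  continuousOn := by fun_prop
  strictMonoOn := fun _ _ _ _ h => mul_lt_mul_of_pos_left h hr
  map_zero := mul_zero r
  unbounded c := ⟨(|c| + 1) / r, by positivity, by
    rw [mul_div_cancel₀ _ hr.ne']; linarith [le_abs_self c]⟩

variable {Ω : Type*} [MeasurableSpace Ω] {μ : Measure Ω} [IsProbabilityMeasure μ]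

theorem integrable_quad_add_inner (S : Matrix (Fin n) (Fin n) ℝ) (q : Vec n) {X : Ω → Vec n}
    (hX : MemLp X 2 μ) : Integrable (fun ω => quad S (X ω) + inner ℝ q (X ω)) μ :=
  (integrable_quad S hX).add (integrable_inner_const q hX)

theorem isErrorDissipative_of_point (hQ₂ : C.Q₂.PosSemidef) (hR₂ : C.R₂.PosSemidef)
    {S : Matrix (Fin n) (Fin n) ℝ} {q xt : Vec n} {ut : Vec l} {r : ℝ}
    (h : ∀ x u, r * ‖x - xt‖ ^ 2 ≤ C.point x u - C.point xt ut + (quad S x + inner ℝ q x)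
      - (quad S (act D.A x + act D.B u) + inner ℝ q (act D.A x + act D.B u))) :
    IsErrorDissipative D C μ S q xt ut (fun t => r * t) := by
  intro X U hX hU
  have hX' : MemLp (fun ω => act D.A (X ω) + act D.B (U ω)) 2 μ :=
    (memLp_act D.A hX).add (memLp_act D.B hU)
  have hdist : Integrable (fun ω => r * ‖X ω - xt‖ ^ 2) μ :=
    ((hX.sub (memLp_const xt)).integrable_norm_pow two_ne_zero).const_mul r
  have hcost : Integrable (fun ω => C.point (X ω) (U ω) - C.point xt ut) μ :=
    (C.integrable_point hX hU).sub (integrable_const _)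
  have hstorage := integrable_quad_add_inner S q hX
  have hstorage' := integrable_quad_add_inner S q hX'
  have hmean := integral_mono hdist (by exact (hcost.add hstorage).sub hstorage')
    fun ω => h (X ω) (U ω)
  simp only [integral_const_mul] at hmean
  rw [integral_sub (by exact hcost.add hstorage) hstorage', integral_add hcost hstorage,
    integral_sub (C.integrable_point hX hU) (integrable_const _), integral_const, probReal_univ,
    one_smul] at hmean
  have hell : C.ell μ X U = ∫ ω, C.point (X ω) (U ω) ∂μ
    + (C.Q₂ * covMat μ X).trace + (C.R₂ * covMat μ U).trace := rfl
  rw [C.ell_const, hell]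
  simp only [errorStorage]
  linarith [trace_mul_covMat_nonneg hQ₂ hX, trace_mul_covMat_nonneg hR₂ hU]

end ErrorSystem

section Storage

variable {n : ℕ} {P S : Matrix (Fin n) (Fin n) ℝ}

theorem quad_add_sub_quad_add_inner (hP : P.IsHermitian) (q y z : Vec n) :
    quad (P + S) y - quad P (y + z) + inner ℝ q y
      = quad S y + inner ℝ q y - 2 * inner ℝ y (act P z) - quad P z := by
  rw [add_quad, quad_add hP]
  ring

theorem exists_neg_le_quad_add_inner (hS : S.PosDef) :
    ∃ c : ℝ, ∀ q y, -(c * ‖q‖ ^ 2) ≤ quad S y + inner ℝ q y := by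
  obtain ⟨a, ha, hquad⟩ := exists_le_quad hS
  refine ⟨(4 * a)⁻¹, fun q y => ?_⟩
  have hinner : -(‖q‖ * ‖y‖) ≤ inner ℝ q y := neg_le_of_abs_le (abs_real_inner_le_norm q y)
  have hsquare : a * ‖y‖ ^ 2 - ‖q‖ * ‖y‖ + (4 * a)⁻¹ * ‖q‖ ^ 2
      = (4 * a)⁻¹ * (2 * a * ‖y‖ - ‖q‖) ^ 2 := by
    field_simp
    ring
  have hnonneg : 0 ≤ (4 * a)⁻¹ * (2 * a * ‖y‖ - ‖q‖) ^ 2 := by positivity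
  linarith [hquad y]

variable {Ω : Type*} [MeasurableSpace Ω] {μ : Measure Ω} [IsProbabilityMeasure μ]

theorem storage_eq (hP : P.IsHermitian) (q xs xt : Vec n) {Xs : ℕ → Ω → Vec n} {k : ℕ}
    {X : Ω → Vec n} (hX : MemLp X 2 μ) (hXs : MemLp (Xs k) 2 μ) :
    storage μ P S q xs xt Xs k X = errorStorage μ S q (fun ω => X ω - (Xs k ω - xt))
      - 2 * ∫ ω, inner ℝ (X ω - (Xs k ω - xt)) (act P (Xs k ω - xt - xs)) ∂μ
      - ∫ ω, quad P (Xs k ω - xt - xs) ∂μ := by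
  have hY : MemLp (fun ω => X ω - (Xs k ω - xt)) 2 μ := hX.sub (hXs.sub (memLp_const xt))
  have hZ : MemLp (fun ω => Xs k ω - xt - xs) 2 μ := (hXs.sub (memLp_const xt)).sub (memLp_const xs)
  have hstorage := integrable_quad_add_inner S q hY
  have hcross := (integrable_inner hY (memLp_act P hZ)).const_mul 2
  have hsum (ω : Ω) : X ω - xs = (X ω - (Xs k ω - xt)) + (Xs k ω - xt - xs) := by abel
  simp only [storage, hsum, quad_add_sub_quad_add_inner hP]
  rw [integral_sub (by exact hstorage.sub hcross) (integrable_quad P hZ),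
    integral_sub hstorage hcross, integral_const_mul, errorStorage]

theorem exists_le_storage (hP : P.IsHermitian) (hS : S.PosDef) (q xs xt : Vec n)
    {Xs : ℕ → Ω → Vec n} {ρX : Measure (Vec n)} (hρX : IsP2 ρX) (hlaw : ∀ k, HasLaw (Xs k) ρX μ) :
    ∃ b : ℝ, ∀ k X, MemLp X 2 μ → b ≤ storage μ P S q xs xt Xs k X := by
  obtain ⟨c, hc⟩ := exists_neg_le_quad_add_inner hS
  set g : Vec n → ℝ := fun x =>
    -(c * ‖q - (2 : ℝ) • act P (x - xt - xs)‖ ^ 2) - quad P (x - xt - xs)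
  have hg : Continuous g := by
    have := continuous_act P
    unfold g quad
    fun_prop
  refine ⟨∫ x, g x ∂ρX, fun k X hX => ?_⟩
  have hXs := hρX.memLp_of_hasLaw (hlaw k)
  have hY : MemLp (fun ω => X ω - (Xs k ω - xt)) 2 μ := hX.sub (hXs.sub (memLp_const xt))
  have hZ : MemLp (fun ω => Xs k ω - xt - xs) 2 μ := (hXs.sub (memLp_const xt)).sub (memLp_const xs)
  rw [← (hlaw k).integral_comp hg.aestronglyMeasurable]
  refine integral_mono ?_ ?_ fun ω => ?_
  · exact ((((memLp_const q).sub ((memLp_act P hZ).const_smul (2 : ℝ))).integrable_norm_pow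
      two_ne_zero).const_mul c).neg.sub (integrable_quad P hZ)
  · exact ((integrable_quad (P + S) hY).sub (integrable_quad P (hX.sub (memLp_const xs)))).add
      (integrable_inner_const q hY)
  · have hsum : X ω - xs = (X ω - (Xs k ω - xt)) + (Xs k ω - xt - xs) := by abel
    have hbound := hc (q - (2 : ℝ) • act P (Xs k ω - xt - xs)) (X ω - (Xs k ω - xt))
    rw [inner_sub_left, real_inner_smul_left,
      real_inner_comm (X ω - (Xs k ω - xt)) (act P (Xs k ω - xt - xs))] at hbound
    simp only [g, Function.comp_apply, hsum, quad_add_sub_quad_add_inner hP]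
    linarith

end Storage

section StationaryPair

variable {n l m : ℕ} {D : Dynamics n l m} {K : Matrix (Fin l) (Fin n) ℝ} {xs xt : Vec n}
  {us ut : Vec l}

theorem Dynamics.measurable_f (D : Dynamics n l m) {π : Vec n → Vec l} (hπ : Measurable π) :
    Measurable fun p : Vec n × Vec m => D.f p.1 (π p.1) p.2 := by
  have := (continuous_act D.A).measurable
  have := (continuous_act D.B).measurable
  have := (continuous_act D.E).measurable
  simp only [Dynamics.f]
  fun_prop

theorem Dynamics.f_feedback (D : Dynamics n l m) (K : Matrix (Fin l) (Fin n) ℝ) {w₀ : Vec m}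
    (hs : act (1 - D.A) xs - act D.B us = act D.E w₀ + D.z)
    (ht : act (1 - D.A) xt - act D.B ut = 0) (x : Vec n) (w : Vec m) :
    D.f x (act K (x - xt - xs) + ut + us) w
      = act (D.A + D.B * K) (x - xt - xs) + act D.E (w - w₀) + (xt + xs) := by
  rw [sub_act, one_act] at hs ht
  rw [Dynamics.f, add_act, mul_act]
  simp only [map_add, map_sub]
  linear_combination (norm := module) -ht - hs

theorem Dynamics.f_sub_f_sub (D : Dynamics n l m) (ht : act (1 - D.A) xt - act D.B ut = 0)
    (x x' : Vec n) (u u' : Vec l) (w : Vec m) :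
    D.f x u w - (D.f x' u' w - xt) = act D.A (x - (x' - xt)) + act D.B (u - (u' - ut)) := by
  rw [sub_act, one_act] at ht
  simp only [Dynamics.f, map_sub]
  linear_combination (norm := module) ht

theorem exists_isInvariant {ρW : Measure (Vec m)} (hρW : IsP2 ρW)
    (hs : act (1 - D.A) xs - act D.B us = act D.E (∫ w, w ∂ρW) + D.z)
    (ht : act (1 - D.A) xt - act D.B ut = 0)
    (hK : Tendsto (fun k => (D.A + D.B * K) ^ k) atTop (𝓝 0)) :
    ∃ ρX, IsP2 ρX ∧ IsInvariant D ρW (fun x => act K (x - xt - xs) + ut + us) ρX := by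
  obtain ⟨_, hW⟩ := isP2_iff.1 hρW
  set b : Vec m → Vec n := fun w =>
    act D.E (w - ∫ w, w ∂ρW) + (xt + xs - act (D.A + D.B * K) (xt + xs))
  have hb : MemLp b 2 ρW := (memLp_act D.E (hW.sub (memLp_const _))).add (memLp_const _)
  have hbm : Measurable b := by
    have := (continuous_act D.E).measurable
    fun_prop
  obtain ⟨ρX, hprob, hX, hinv⟩ :=
    exists_measurePreserving_affine (tendsto_toEuclideanCLM_pow hK) hbm hb
  refine ⟨ρX, isP2_iff.2 ⟨hprob, hX⟩, ?_⟩
  have hstep (p : Vec n × Vec m) : D.f p.1 (act K (p.1 - xt - xs) + ut + us) p.2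
      = Matrix.toEuclideanCLM (𝕜 := ℝ) (D.A + D.B * K) p.1 + b p.2 := by
    change _ = act (D.A + D.B * K) p.1 + b p.2
    rw [D.f_feedback K hs ht, sub_sub]
    simp only [b, map_sub]
    abel
  simp only [IsInvariant, hstep]
  exact hinv.map_eq

variable {Ω : Type*} [MeasurableSpace Ω] {μ : Measure Ω} {W : ℕ → Ω → Vec m}
  {Xs : ℕ → Ω → Vec n} {Us : ℕ → Ω → Vec l} {ρX : Measure (Vec n)} {ρU : Measure (Vec l)}

theorem IsStationaryPair.state_succ_sub (h : IsStationaryPair D μ W Xs Us ρX ρU) {w₀ : Vec m}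
    (hs : act (1 - D.A) xs - act D.B us = act D.E w₀ + D.z)
    (ht : act (1 - D.A) xt - act D.B ut = 0)
    (hUs : ∀ k ω, Us k ω = act K (Xs k ω - xt - xs) + ut + us) (k : ℕ) (ω : Ω) :
    Xs (k + 1) ω - xt - xs
      = act (D.A + D.B * K) (Xs k ω - xt - xs) + act D.E (W k ω - w₀) := by
  rw [h.step, hUs, D.f_feedback K hs ht]
  abel

variable [IsProbabilityMeasure μ] {ρW : Measure (Vec m)}

theorem isStationaryPair_trajectory (hρW : IsP2 ρW) (hWlaw : ∀ k, HasLaw (W k) ρW μ)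
    (hWindep : iIndepFun W μ) {π : Vec n → Vec l} (hπ : Measurable π)
    (hρX : IsP2 ρX) (hπ2 : MemLp π 2 ρX) (hinv : IsInvariant D ρW π ρX) {X₀ : Ω → Vec n}
    (hX₀ : HasLaw X₀ ρX μ) (hX₀W : IndepFun X₀ (fun ω k => W k ω) μ) :
    IsStationaryPair D μ W (trajectory (fun p => D.f p.1 (π p.1) p.2) X₀ W)
      (fun k ω => π (trajectory (fun p => D.f p.1 (π p.1) p.2) X₀ W k ω)) ρX (ρX.map π) := by
  have := hρX.isProbabilityMeasure
  have := hρW.isProbabilityMeasure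
  have hnoise : HasLaw (fun ω k => W k ω) (Measure.infinitePi fun _ => ρW) μ :=
    hWindep.hasLaw_infinitePi hWlaw (aemeasurable_pi_lambda _ fun k => (hWlaw k).aemeasurable)
  have hlaw := hasLaw_trajectory ⟨D.measurable_f hπ, hinv⟩
    ((indepFun_iff_hasLaw_prodMk_prod hX₀ hnoise).1 hX₀W)
  have hstate k := (measurePreserving_fst.hasLaw).fun_comp (hlaw k)
  have hindep k := (indepFun_iff_hasLaw_prodMk_prod (hstate k) (hWlaw k)).2 (hlaw k)
  exact ⟨hρX, isP2_map hπ2, hstate, fun k => HasLaw.fun_comp ⟨hπ.aemeasurable, rfl⟩ (hstate k),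
    hindep, fun k => (hindep k).comp hπ measurable_id, fun _ _ => rfl⟩

theorem IsStationaryPair.integral_state_sub_eq_zero (h : IsStationaryPair D μ W Xs Us ρX ρU)
    (hρW : IsP2 ρW) (hWlaw : ∀ k, HasLaw (W k) ρW μ)
    (hs : act (1 - D.A) xs - act D.B us = act D.E (∫ w, w ∂ρW) + D.z)
    (ht : act (1 - D.A) xt - act D.B ut = 0)
    (hUs : ∀ k ω, Us k ω = act K (Xs k ω - xt - xs) + ut + us)
    (hK : Tendsto (fun k => (D.A + D.B * K) ^ k) atTop (𝓝 0)) (k : ℕ) :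
    ∫ ω, (Xs k ω - xt - xs) ∂μ = 0 := by
  have hZ (j) : MemLp (fun ω => Xs j ω - xt - xs) 2 μ :=
    ((h.isP2_state.memLp_of_hasLaw (h.law_state j)).sub (memLp_const xt)).sub (memLp_const xs)
  have hN : Integrable (fun ω => W k ω - ∫ w, w ∂ρW) μ :=
    ((hρW.memLp_of_hasLaw (hWlaw k)).integrable one_le_two).sub (integrable_const _)
  have hmean (j) : ∫ ω, (Xs j ω - xt - xs) ∂μ = ∫ x, (x - xt - xs) ∂ρX :=
    (h.law_state j).integral_comp (f := fun x => x - xt - xs) (by fun_prop)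
  refine eq_zero_of_act_eq_self hK ?_
  have hk := hmean (k + 1)
  simp only [h.state_succ_sub hs ht hUs] at hk
  rw [integral_add (integrable_act _ ((hZ k).integrable one_le_two)) (integrable_act _ hN),
    integral_act _ ((hZ k).integrable one_le_two), integral_act _ hN,
    integral_sub_mean_eq_zero hρW (hWlaw k), ← hmean k] at hk
  simpa only [map_zero, add_zero] using hk

end StationaryPair

section Dissipation

variable {n l m : ℕ} {D : Dynamics n l m} {C : Cost n l} {P S : Matrix (Fin n) (Fin n) ℝ}
  {xs xt q : Vec n} {us ut : Vec l}
variable {Ω : Type*} [MeasurableSpace Ω] {μ : Measure Ω}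

theorem IsRiccatiSolution.integral_inner (hP : IsRiccatiSolution D C P)
    (hR : (C.R₁ + C.R₂).PosDef) {Y Z : Ω → Vec n} {T : Ω → Vec l} (hY : MemLp Y 2 μ)
    (hT : MemLp T 2 μ) (hZ : MemLp Z 2 μ) :
    ∫ ω, inner ℝ (Y ω) (act (C.Q₁ + C.Q₂) (Z ω)) ∂μ
        + ∫ ω, inner ℝ (T ω) (act (C.R₁ + C.R₂) (act (gain D C P) (Z ω))) ∂μ
        + ∫ ω, inner ℝ (act D.A (Y ω) + act D.B (T ω))
            (act P (act (D.A + D.B * gain D C P) (Z ω))) ∂μ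
      = ∫ ω, inner ℝ (Y ω) (act P (Z ω)) ∂μ := by
  have hstate := integrable_inner hY (memLp_act (C.Q₁ + C.Q₂) hZ)
  have hcontrol := integrable_inner hT (memLp_act (C.R₁ + C.R₂) (memLp_act (gain D C P) hZ))
  have hAYBT : MemLp (fun ω => act D.A (Y ω) + act D.B (T ω)) 2 μ :=
    (memLp_act D.A hY).add (memLp_act D.B hT)
  have hnext := integrable_inner hAYBT (memLp_act P (memLp_act (D.A + D.B * gain D C P) hZ))
  obtain ⟨hpos, hfix⟩ := isRiccatiSolution_iff.1 hP
  rw [← integral_add hstate hcontrol, ← integral_add (by exact hstate.add hcontrol) hnext]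
  refine integral_congr_ae (ae_of_all _ fun ω => ?_)
  have h := inner_riccatiMap (A := D.A) (B := D.B) (Q := C.Q₁ + C.Q₂) hR hpos (Y ω) (T ω) (Z ω)
  rwa [hfix] at h

variable [IsProbabilityMeasure μ]

theorem IsRiccatiSolution.ell_add_centered_sub (hP : IsRiccatiSolution D C P)
    (hQ₁ : C.Q₁.IsHermitian) (hQ₂ : C.Q₂.IsHermitian) (hR₁ : C.R₁.PosDef)
    (hR₂ : C.R₂.PosSemidef) (x : Vec n) (u : Vec l)
    {Y Z : Ω → Vec n} {T : Ω → Vec l} (hY : MemLp Y 2 μ) (hT : MemLp T 2 μ) (hZ : MemLp Z 2 μ)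
    (hZ0 : ∫ ω, Z ω ∂μ = 0) :
    C.ell μ (fun ω => Y ω + Z ω) (fun ω => T ω + act (gain D C P) (Z ω))
        - C.ell μ (fun ω => x + Z ω) (fun ω => u + act (gain D C P) (Z ω))
      = C.ell μ Y T - C.ell μ (fun _ => x) (fun _ => u)
        + 2 * ∫ ω, inner ℝ (Y ω) (act P (Z ω)) ∂μ
        - 2 * ∫ ω, inner ℝ (act D.A (Y ω) + act D.B (T ω))
            (act P (act (D.A + D.B * gain D C P) (Z ω))) ∂μ := by
  have hKZ0 : ∫ ω, act (gain D C P) (Z ω) ∂μ = 0 := by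
    simp only [integral_act _ (hZ.integrable one_le_two), hZ0, map_zero]
  rw [C.ell_add_centered_sub_ell_add_centered hQ₁ hQ₂ hR₁.1 hR₂.1 x u hY hT hZ (memLp_act _ hZ)
    hZ0 hKZ0]
  linarith [hP.integral_inner (hR₁.add_posSemidef hR₂) hY hT hZ]

theorem IsRiccatiSolution.ell_sub_ell (hP : IsRiccatiSolution D C P)
    (hQ₁ : C.Q₁.IsHermitian) (hQ₂ : C.Q₂.IsHermitian) (hR₁ : C.R₁.PosDef)
    (hR₂ : C.R₂.PosSemidef) {X X' : Ω → Vec n} {U U' : Ω → Vec l}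
    (hX : MemLp X 2 μ) (hU : MemLp U 2 μ) (hX' : MemLp X' 2 μ) (hU' : MemLp U' 2 μ)
    (hfeedback : ∀ ω, U' ω = act (gain D C P) (X' ω - xt - xs) + ut + us)
    (hmean : ∫ ω, (X' ω - xt - xs) ∂μ = 0) :
    C.ell μ X U - C.ell μ X' U'
      = (C.shift xs us).ell μ (fun ω => X ω - (X' ω - xt)) (fun ω => U ω - (U' ω - ut))
        - (C.shift xs us).ell μ (fun _ => xt) (fun _ => ut)
        + 2 * ∫ ω, inner ℝ (X ω - (X' ω - xt)) (act P (X' ω - xt - xs)) ∂μ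
        - 2 * ∫ ω, inner ℝ (act D.A (X ω - (X' ω - xt)) + act D.B (U ω - (U' ω - ut)))
            (act P (act (D.A + D.B * gain D C P) (X' ω - xt - xs))) ∂μ := by
  have hY : MemLp (fun ω => X ω - (X' ω - xt)) 2 μ := hX.sub (hX'.sub (memLp_const xt))
  have hT : MemLp (fun ω => U ω - (U' ω - ut)) 2 μ := hU.sub (hU'.sub (memLp_const ut))
  have hZ : MemLp (fun ω => X' ω - xt - xs) 2 μ := (hX'.sub (memLp_const xt)).sub (memLp_const xs)
  have hKZ := memLp_act (gain D C P) hZ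
  have hshift {x : Ω → Vec n} {u : Ω → Vec l} (hx : MemLp x 2 μ) (hu : MemLp u 2 μ) :=
    C.ell_shift hQ₁ hR₁.1 xs us (hx.integrable one_le_two) (hu.integrable one_le_two)
  refine Eq.trans ?_ (IsRiccatiSolution.ell_add_centered_sub (C := C.shift xs us) hP hQ₁ hQ₂ hR₁ hR₂
    xt ut hY hT hZ hmean)
  refine Eq.trans ?_ (congrArg₂ (· - ·) (hshift (hY.add hZ) (hT.add hKZ))
    (hshift ((memLp_const xt).add hZ) ((memLp_const ut).add hKZ))).symm
  congr 2 <;> ext1 ω <;> simp only [Pi.add_apply, hfeedback] <;> abel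

theorem integral_inner_sub_eq_zero_of_indepFun {d : ℕ} (A : Matrix (Fin d) (Fin n) ℝ)
    (M : Matrix (Fin d) (Fin m) ℝ) {X X' : Ω → Vec n} {N : Ω → Vec m} (x : Vec n)
    (hX : MemLp X 2 μ) (hX' : MemLp X' 2 μ) (hN : MemLp N 2 μ) (hXN : IndepFun X N μ)
    (hX'N : IndepFun X' N μ) (hN0 : ∫ ω, N ω ∂μ = 0) :
    ∫ ω, inner ℝ (act A (X ω - (X' ω - x))) (act M (N ω)) ∂μ = 0 := by
  have hzero {V : Ω → Vec n} (hV : MemLp V 2 μ) (hVN : IndepFun V N μ) :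
      ∫ ω, inner ℝ (V ω) (act (Aᵀ * M) (N ω)) ∂μ = 0 :=
    integral_inner_act_eq_zero_of_indepFun _ (hV.integrable one_le_two) (hN.integrable one_le_two)
      hVN hN0
  have hint {V : Ω → Vec n} (hV : MemLp V 2 μ) := integrable_inner hV (memLp_act (Aᵀ * M) hN)
  have hadjoint (ω) : inner ℝ (act A (X ω - (X' ω - x))) (act M (N ω))
      = inner ℝ (X ω) (act (Aᵀ * M) (N ω)) - (inner ℝ (X' ω) (act (Aᵀ * M) (N ω))
        - inner ℝ x (act (Aᵀ * M) (N ω))) := by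
    rw [mul_act, ← inner_sub_left, ← inner_sub_left, inner_act Aᵀ,
      Matrix.transpose_transpose]
  simp only [hadjoint]
  rw [integral_sub (hint hX) (by exact (hint hX').sub (hint (memLp_const x))),
    integral_sub (hint hX') (hint (memLp_const x)), hzero hX hXN, hzero hX' hX'N,
    hzero (memLp_const x) (indepFun_const_left x N)]
  ring

variable {W : ℕ → Ω → Vec m} {ρW : Measure (Vec m)} {Xs : ℕ → Ω → Vec n} {Us : ℕ → Ω → Vec l}
  {ρX : Measure (Vec n)} {ρU : Measure (Vec l)} {K : Matrix (Fin l) (Fin n) ℝ}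

theorem IsStationaryPair.integral_inner_act_succ (h : IsStationaryPair D μ W Xs Us ρX ρU)
    (hρW : IsP2 ρW) (hWlaw : ∀ k, HasLaw (W k) ρW μ)
    (hs : act (1 - D.A) xs - act D.B us = act D.E (∫ w, w ∂ρW) + D.z)
    (ht : act (1 - D.A) xt - act D.B ut = 0)
    (hUs : ∀ k ω, Us k ω = act K (Xs k ω - xt - xs) + ut + us) (P : Matrix (Fin n) (Fin n) ℝ)
    (k : ℕ) {X : Ω → Vec n} {U : Ω → Vec l} (hX : MemLp X 2 μ) (hU : MemLp U 2 μ)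
    (hXW : IndepFun X (W k) μ) (hUW : IndepFun U (W k) μ) :
    ∫ ω, inner ℝ (act D.A (X ω - (Xs k ω - xt)) + act D.B (U ω - (Us k ω - ut)))
        (act P (Xs (k + 1) ω - xt - xs)) ∂μ
      = ∫ ω, inner ℝ (act D.A (X ω - (Xs k ω - xt)) + act D.B (U ω - (Us k ω - ut)))
        (act P (act (D.A + D.B * K) (Xs k ω - xt - xs))) ∂μ := by
  have hXs := h.isP2_state.memLp_of_hasLaw (h.law_state k)
  have hUsk := h.isP2_control.memLp_of_hasLaw (h.law_control k)
  have hY : MemLp (fun ω => X ω - (Xs k ω - xt)) 2 μ := hX.sub (hXs.sub (memLp_const xt))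
  have hT : MemLp (fun ω => U ω - (Us k ω - ut)) 2 μ := hU.sub (hUsk.sub (memLp_const ut))
  have hZ : MemLp (fun ω => Xs k ω - xt - xs) 2 μ :=
    (hXs.sub (memLp_const xt)).sub (memLp_const xs)
  have hnext : MemLp (fun ω => act D.A (X ω - (Xs k ω - xt)) + act D.B (U ω - (Us k ω - ut)))
      2 μ := (memLp_act D.A hY).add (memLp_act D.B hT)
  have hN : MemLp (fun ω => W k ω - ∫ w, w ∂ρW) 2 μ :=
    (hρW.memLp_of_hasLaw (hWlaw k)).sub (memLp_const _)
  have hN0 := integral_sub_mean_eq_zero hρW (hWlaw k)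
  have hindep {d : ℕ} {V : Ω → Vec d} (hV : IndepFun V (W k) μ) :
      IndepFun V (fun ω => W k ω - ∫ w, w ∂ρW) μ :=
    hV.comp (ψ := fun w => w - ∫ w, w ∂ρW) measurable_id (by fun_prop)
  have hstate := integral_inner_sub_eq_zero_of_indepFun D.A (P * D.E) xt hX hXs hN
    (hindep hXW) (hindep (h.indep_state k)) hN0
  have hcontrol := integral_inner_sub_eq_zero_of_indepFun D.B (P * D.E) ut hU hUsk hN
    (hindep hUW) (hindep (h.indep_control k)) hN0
  have hstep (ω) : act P (Xs (k + 1) ω - xt - xs)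
      = act P (act (D.A + D.B * K) (Xs k ω - xt - xs))
        + act (P * D.E) (W k ω - ∫ w, w ∂ρW) := by
    rw [h.state_succ_sub hs ht hUs, mul_act]
    exact map_add _ _ _
  simp only [hstep, inner_add_right]
  rw [integral_add (integrable_inner hnext (memLp_act P (memLp_act _ hZ)))
    (integrable_inner hnext (memLp_act _ hN)), add_eq_left]
  simp only [inner_add_left]
  rw [integral_add (integrable_inner (memLp_act D.A hY) (memLp_act _ hN))
    (integrable_inner (memLp_act D.B hT) (memLp_act _ hN)),
    hstate, hcontrol, add_zero]

theorem IsStationaryPair.storage_succ (h : IsStationaryPair D μ W Xs Us ρX ρU)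
    (hρW : IsP2 ρW) (hWlaw : ∀ k, HasLaw (W k) ρW μ)
    (hs : act (1 - D.A) xs - act D.B us = act D.E (∫ w, w ∂ρW) + D.z)
    (ht : act (1 - D.A) xt - act D.B ut = 0)
    (hUs : ∀ k ω, Us k ω = act K (Xs k ω - xt - xs) + ut + us) (hP : P.IsHermitian) (k : ℕ)
    {X : Ω → Vec n} {U : Ω → Vec l} (hX : MemLp X 2 μ) (hU : MemLp U 2 μ)
    (hXW : IndepFun X (W k) μ) (hUW : IndepFun U (W k) μ) :
    storage μ P S q xs xt Xs (k + 1) (fun ω => D.f (X ω) (U ω) (W k ω))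
      = errorStorage μ S q (fun ω =>
          act D.A (X ω - (Xs k ω - xt)) + act D.B (U ω - (Us k ω - ut)))
        - 2 * ∫ ω, inner ℝ (act D.A (X ω - (Xs k ω - xt)) + act D.B (U ω - (Us k ω - ut)))
            (act P (act (D.A + D.B * K) (Xs k ω - xt - xs))) ∂μ
        - ∫ ω, quad P (Xs k ω - xt - xs) ∂μ := by
  have hX' : MemLp (fun ω => D.f (X ω) (U ω) (W k ω)) 2 μ :=
    (((memLp_act D.A hX).add (memLp_act D.B hU)).add
      (memLp_act D.E (hρW.memLp_of_hasLaw (hWlaw k)))).add (memLp_const D.z)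
  have herror (ω) : D.f (X ω) (U ω) (W k ω) - (Xs (k + 1) ω - xt)
      = act D.A (X ω - (Xs k ω - xt)) + act D.B (U ω - (Us k ω - ut)) := by
    rw [h.step, D.f_sub_f_sub ht]
  have hquad (j) : ∫ ω, quad P (Xs j ω - xt - xs) ∂μ = ∫ x, quad P (x - xt - xs) ∂ρX := by
    have := continuous_act P
    exact (h.law_state j).integral_comp (f := fun x => quad P (x - xt - xs))
      (Continuous.aestronglyMeasurable (by unfold quad; fun_prop))
  rw [storage_eq hP q xs xt hX' (h.isP2_state.memLp_of_hasLaw (h.law_state (k + 1))),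
    hquad (k + 1), ← hquad k]
  simp only [herror, h.integral_inner_act_succ hρW hWlaw hs ht hUs P k hX hU hXW hUW]

theorem IsStationaryPair.isStrictlyDissipative (h : IsStationaryPair D μ W Xs Us ρX ρU)
    (hQ₁ : C.Q₁.IsHermitian) (hQ₂ : C.Q₂.IsHermitian) (hR₁ : C.R₁.PosDef) (hR₂ : C.R₂.PosSemidef)
    (hρW : IsP2 ρW) (hWlaw : ∀ k, HasLaw (W k) ρW μ)
    (hs : act (1 - D.A) xs - act D.B us = act D.E (∫ w, w ∂ρW) + D.z)
    (ht : act (1 - D.A) xt - act D.B ut = 0) (hP : IsRiccatiSolution D C P)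
    (hUs : ∀ k ω, Us k ω = act (gain D C P) (Xs k ω - xt - xs) + ut + us)
    (hmean : ∀ k, ∫ ω, (Xs k ω - xt - xs) ∂μ = 0) (hS : S.PosDef) {α : ℝ → ℝ}
    (hα : IsClassKInfty α) (herror : IsErrorDissipative D (C.shift xs us) μ S q xt ut α) :
    IsStrictlyDissipative D C μ W Xs Us (storage μ P S q xs xt Xs) α where
  classKInfty := hα
  bddBelow := exists_le_storage hP.1.1 hS q xs xt h.isP2_state h.law_state
  dissipation k X U hX hU hXW hUW := by
    have hXs := h.isP2_state.memLp_of_hasLaw (h.law_state k)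
    have hUsk := h.isP2_control.memLp_of_hasLaw (h.law_control k)
    have hdissipation := herror _ _ (hX.sub (hXs.sub (memLp_const xt)))
      (hU.sub (hUsk.sub (memLp_const ut)))
    have hcost := hP.ell_sub_ell hQ₁ hQ₂ hR₁ hR₂ hX hU hXs hUsk (hUs k) (hmean k)
    have hdist (ω) : X ω - (Xs k ω - xt) - xt = X ω - Xs k ω := by abel
    simp only [Pi.sub_apply, hdist] at hdissipation
    rw [hcost, storage_eq hP.1.1 q xs xt hX hXs,
      h.storage_succ hρW hWlaw hs ht hUs hP.1.1 k hX hU hXW hUW]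
    refine hdissipation.trans (le_of_eq ?_)
    change (C.shift xs us).ell μ (fun ω => X ω - (Xs k ω - xt)) (fun ω => U ω - (Us k ω - ut)) - _
      + errorStorage μ S q (fun ω => X ω - (Xs k ω - xt)) - _ = _
    ring

theorem exists_isStationaryPair (hρW : IsP2 ρW) (hWlaw : ∀ k, HasLaw (W k) ρW μ)
    (hWindep : iIndepFun W μ)
    (hΩ : ∀ ρ : Measure (Vec n), IsP2 ρ →
      ∃ X₀ : Ω → Vec n, HasLaw X₀ ρ μ ∧ IndepFun X₀ (fun ω k => W k ω) μ)
    (hs : act (1 - D.A) xs - act D.B us = act D.E (∫ w, w ∂ρW) + D.z)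
    (ht : act (1 - D.A) xt - act D.B ut = 0)
    (hK : Tendsto (fun k => (D.A + D.B * K) ^ k) atTop (𝓝 0)) :
    ∃ ρX ρU Xs Us, IsInvariant D ρW (fun x => act K (x - xt - xs) + ut + us) ρX ∧
      IndepFun (Xs 0) (fun ω k => W k ω) μ ∧
      (∀ k ω, Us k ω = act K (Xs k ω - xt - xs) + ut + us) ∧
      IsStationaryPair D μ W Xs Us ρX ρU := by
  obtain ⟨ρX, hρX, hinv⟩ := exists_isInvariant hρW hs ht hK
  obtain ⟨X₀, hX₀, hX₀W⟩ := hΩ ρX hρX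
  obtain ⟨_, hid⟩ := isP2_iff.1 hρX
  have hπ : Measurable fun x => act K (x - xt - xs) + ut + us := by
    have := (continuous_act K).measurable
    fun_prop
  have hπ2 : MemLp (fun x => act K (x - xt - xs) + ut + us) 2 ρX :=
    ((memLp_act K ((hid.sub (memLp_const xt)).sub (memLp_const xs))).add (memLp_const ut)).add
      (memLp_const us)
  exact ⟨ρX, _, _, _, hinv, hX₀W, fun _ _ => rfl,
    isStationaryPair_trajectory hρW hWlaw hWindep hπ hρX hπ2 hinv hX₀ hX₀W⟩

end Dissipation

end StochLQ

theorem mainTheorem1 {n l m : ℕ} (D : StochLQ.Dynamics n l m) (C : StochLQ.Cost n l)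
    (hAB : StochLQ.IsStabilizable D.A D.B)
    (hQ₁ : C.Q₁.PosSemidef) (hQ₂ : C.Q₂.PosSemidef) (hR₁ : C.R₁.PosDef) (hR₂ : C.R₂.PosSemidef)
    {Ω : Type*} [MeasurableSpace Ω] (μ : Measure Ω) [IsProbabilityMeasure μ]
    -- the noise: an i.i.d. sequence with law `ρW` of finite second moment
    (W : ℕ → Ω → StochLQ.Vec m) (ρW : Measure (StochLQ.Vec m)) (hρW : StochLQ.IsP2 ρW)
    (hWmeas : ∀ k, Measurable (W k)) (hWlaw : ∀ k, HasLaw (W k) ρW μ) (hWindep : iIndepFun W μ)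
    -- the probability space carries initial values of every law, independent of the noise
    (hΩ : ∀ ρ : Measure (StochLQ.Vec n), StochLQ.IsP2 ρ →
      ∃ X₀ : Ω → StochLQ.Vec n, Measurable X₀ ∧ HasLaw X₀ ρ μ ∧
        IndepFun X₀ (fun ω k => W k ω) μ)
    -- a steady state of the deterministic system
    (xs : StochLQ.Vec n) (us : StochLQ.Vec l)
    (hs : StochLQ.act (1 - D.A) xs - StochLQ.act D.B us
      = StochLQ.act D.E (∫ w, w ∂ρW) + D.z)
    (hdet : StochLQ.IsDetectable D.A (CFC.sqrt C.Q₁)) :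
    -- the positive semidefinite solution of the Riccati equation
    ∃ P : Matrix (Fin n) (Fin n) ℝ, StochLQ.IsRiccatiSolution D C P ∧
      (∀ P', StochLQ.IsRiccatiSolution D C P' → P' = P) ∧
    -- the data of the error system, with the linear comparison function `α(t) = r t`
    ∃ (S : Matrix (Fin n) (Fin n) ℝ) (q xt : StochLQ.Vec n) (ut : StochLQ.Vec l) (r : ℝ),
      S.PosDef ∧ 0 < r ∧
      StochLQ.act (1 - D.A) xt - StochLQ.act D.B ut = 0 ∧
      StochLQ.IsErrorDissipative D (C.shift xs us) μ S q xt ut (fun t => r * t) ∧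
    -- the invariant distribution and the stationary pair
    ∃ (ρX : Measure (StochLQ.Vec n)) (ρU : Measure (StochLQ.Vec l))
      (Xs : ℕ → Ω → StochLQ.Vec n) (Us : ℕ → Ω → StochLQ.Vec l),
      StochLQ.IsInvariant D ρW
        (fun x => StochLQ.act (StochLQ.gain D C P) (x - xt - xs) + ut + us) ρX ∧
      IndepFun (Xs 0) (fun ω k => W k ω) μ ∧
      (∀ k ω, Us k ω = StochLQ.act (StochLQ.gain D C P) (Xs k ω - xt - xs) + ut + us) ∧
      StochLQ.IsStationaryPair D μ W Xs Us ρX ρU ∧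
      StochLQ.IsStrictlyDissipative D C μ W Xs Us
        (StochLQ.storage μ P S q xs xt Xs) (fun t => r * t) := by
  have hR := hR₁.add_posSemidef hR₂
  obtain ⟨S, r, hS⟩ := hdet.exists_isStrictStorage hQ₁ hR₁ D.B
  have hS' := hS.add_weights hQ₂ hR₂
  obtain ⟨P, hP, hfix⟩ := hAB.exists_riccatiMap_eq (hQ₁.add hQ₂) hR
  have hPsol := StochLQ.isRiccatiSolution_iff.2 ⟨hP, hfix⟩
  have hunique P' (hP' : StochLQ.IsRiccatiSolution D C P') : P' = P :=
    have ⟨hP'pos, hfix'⟩ := StochLQ.isRiccatiSolution_iff.1 hP'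
    hS'.riccatiMap_fixedPoint_unique hR hP hfix hP'pos hfix'
  have hK := (hS'.isLyapunov_closedLoop hR hP hfix).tendsto_pow
  obtain ⟨q, xt, ut, ht, hpoint⟩ := (C.shift xs us).exists_point_dissipation hAB hQ₁ hR₁ hS
  have herror : StochLQ.IsErrorDissipative D (C.shift xs us) μ S q xt ut (fun t => r * t) :=
    StochLQ.isErrorDissipative_of_point (C := C.shift xs us) hQ₂ hR₂ hpoint
  obtain ⟨ρX, ρU, Xs, Us, hinv, hindep, hUs, hst⟩ :=
    StochLQ.exists_isStationaryPair (us := us) hρW hWlaw hWindep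
      (fun ρ hρ => (hΩ ρ hρ).imp fun _ h => h.2) hs ht hK
  have hmean := hst.integral_state_sub_eq_zero hρW hWlaw hs ht hUs hK
  exact ⟨P, hPsol, hunique, S, q, xt, ut, r, hS.posDef, hS.pos, ht, herror, ρX, ρU, Xs, Us, hinv,
    hindep, hUs, hst, hst.isStrictlyDissipative hQ₁.1 hQ₂.1 hR₁ hR₂ hρW hWlaw hs ht hPsol hUs hmean
      hS.posDef (StochLQ.isClassKInfty_mul_left hS.pos) herror⟩
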